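/- **Conventions.** A finite simplicial complex $C$ is a finite set of nonempty finite vertex sets (faces), closed under nonempty subsets; $\dim\sigma=|\sigma|-1$, and $d=\dim C$. A face $\sigma$ of $C$ is *free* if exactly one face of $C$ properly contains it. A *discrete Morse function* (Forman) on $C$ is a map $f:C\to\mathbb R$ such that every face $\sigma$ satisfies $\#\{\tau\supset\sigma:\dim\tau=\dim\sigma+1,\ f(\tau)\le f(\sigma)\}\le 1$ and $\#\{\rho\subset\sigma:\dim\rho=\dim\sigma-1,\ f(\rho)\ge f(\sigma)\}\le 1$; the face $\sigma$ is *critical* if both numbers are $0$. Its *discrete Morse vector* is $(c_0,\dots,c_d)$, where $c_i$ is the number of critical $i$-faces. A discrete Morse vector of $C$ is *optimal* if it minimizes $c_0+\dots+c_d$ among all discrete Morse vectors of $C$. A *monotone discrete Morse function* on $C$ is a map $f:C\to\mathbb Z$ such that 1. if $\sigma\subseteq\tau$ then $f(\sigma)\le f(\tau)$; 2. $|f^{-1}(q)|\le 2$ for each $q\in\mathbb Z$; 3. if $f(\sigma)=f(\tau)$ then $\sigma\subseteq\tau$ or $\tau\subseteq\sigma$; 4. if $\sigma\subsetneq\tau$,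 $\sigma'\subsetneq\tau'$ and $f(\sigma)=f(\tau)\le f(\sigma')=f(\tau')$, then $\dim\tau\le\dim\tau'$; 5. $f(C)=\{0,1,\dots,M\}$ for some $M\in\mathbb N$; 6. for any critical face $\Delta$ (a face with $f(\sigma)\ne f(\Delta)$ for all faces $\sigma\ne\Delta$), the complex $\{\sigma\in C: f(\sigma)\le f(\Delta)\}$ has no free face of dimension $\dim\Delta-1$. Its discrete Morse vector counts its critical faces by dimension. The *discrete Morse spectrum* of $C$ is the set of the discrete Morse vectors of all monotone discrete Morse functions on $C$. **The complex two_optima.** It is the $3$-dimensional simplicial complex with vertices $1,\dots,106$ and face vector $(106,596,1064,573)$ whose facets are the following $12$ triangles and $573$ tetrahedra (vertices are separated by spaces). (a) The triangles $1\,3\,23$, $1\,22\,23$, $1\,22\,24$, $1\,22\,25$, $1\,24\,25$, $2\,3\,25$, $2\,22\,23$, $2\,22\,24$, $2\,22\,25$, $2\,23\,24$, $3\,23\,25$, $23\,24\,25$. (b) For $x=7,\dots,13$ and $y=x+7$: $1\,2\,5\,x$, $1\,2\,6\,x$, $1\,3\,5\,x$, $1\,4\,6\,x$, $2\,5\,6\,x$,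 $3\,4\,6\,x$, $3\,5\,6\,x$, $1\,3\,x\,y$, $1\,4\,x\,y$, $3\,4\,x\,y$, $1\,2\,4\,y$, $2\,3\,4\,y$. (c) $2\,3\,14\,15$, $1\,2\,15\,16$, $1\,3\,16\,17$, $2\,3\,17\,18$, $1\,2\,18\,19$, $1\,3\,14\,19$, $1\,3\,15\,20$, $1\,2\,17\,20$, $2\,3\,19\,20$, $1\,15\,16\,17$, $1\,15\,17\,20$, $2\,17\,18\,19$, $2\,17\,19\,20$, $3\,14\,15\,19$, $3\,15\,19\,20$, $15\,17\,19\,20$, $1\,2\,14\,21$, $1\,3\,18\,21$, $1\,14\,19\,21$, $1\,18\,19\,21$, $2\,3\,16\,21$, $2\,14\,15\,21$, $2\,15\,16\,21$, $3\,16\,17\,21$, $3\,17\,18\,21$, $14\,15\,19\,21$, $15\,16\,17\,21$, $15\,17\,19\,21$, $17\,18\,19\,21$, $1\,2\,3\,21$. (d) For each $j=0,\dots,8$, let $a=26+9j$, let $t_1\,t_2\,t_3$ be the $j$-th entry, counted from $0$, of the list $1\,2\,5$, $1\,2\,6$, $1\,2\,4$, $1\,3\,5$, $1\,4\,6$, $2\,3\,4$,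 $2\,5\,6$, $3\,4\,6$, $3\,5\,6$, and write $a_k=a+k$. The tetrahedra are $t_1\,t_2\,a\,a_k$, $t_1\,t_3\,a\,a_k$, $t_2\,t_3\,a\,a_k$ for $k=1,\dots,7$, together with $t_2\,t_3\,a_1\,a_2$, $t_1\,t_2\,a_2\,a_3$, $t_1\,t_3\,a_3\,a_4$, $t_2\,t_3\,a_4\,a_5$, $t_1\,t_2\,a_5\,a_6$, $t_1\,t_3\,a_6\,a_1$, $t_1\,t_3\,a_2\,a_7$, $t_1\,t_2\,a_4\,a_7$, $t_2\,t_3\,a_6\,a_7$, $t_1\,a_2\,a_3\,a_4$, $t_1\,a_2\,a_4\,a_7$, $t_2\,a_4\,a_5\,a_6$, $t_2\,a_4\,a_6\,a_7$, $t_3\,a_1\,a_2\,a_6$, $t_3\,a_2\,a_6\,a_7$, $a_2\,a_4\,a_6\,a_7$, $t_1\,t_2\,t_3\,a_8$, $t_1\,t_2\,a_1\,a_8$, $t_1\,t_3\,a_5\,a_8$, $t_2\,t_3\,a_3\,a_8$, $t_1\,a_1\,a_6\,a_8$, $t_1\,a_5\,a_6\,a_8$, $t_2\,a_1\,a_2\,a_8$,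 $t_2\,a_2\,a_3\,a_8$, $t_3\,a_3\,a_4\,a_8$, $t_3\,a_4\,a_5\,a_8$, $a_1\,a_2\,a_6\,a_8$, $a_2\,a_3\,a_4\,a_8$, $a_4\,a_5\,a_6\,a_8$, $a_2\,a_4\,a_6\,a_8$. **Corollary.** The vector $(1,0,1,1)$ is an optimal discrete Morse vector of two_optima, but no monotone discrete Morse function on two_optima has discrete Morse vector $(1,0,1,1)$. Hence not every optimal discrete Morse vector of two_optima lies in its discrete Morse spectrum. -/

import Mathlib

/-- The faces of a simplicial complex, by dimension: a face with `k + 1` vertices has dimension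
`k`. The dimension of a (nonempty, finite) complex is the largest dimension of a face. -/
noncomputable def complexDim {V : Type*} (K : PreAbstractSimplicialComplex V) : ℕ :=
  sSup {k : ℕ | ∃ σ ∈ K.faces, σ.card = k + 1}

/-- The vector `(c_0, …, c_d)`, where `d` is the dimension of the finite complex `K` and `c_i` is
the number of `i`-dimensional faces of `K` that satisfy `P`. -/
noncomputable def faceCountVector {V : Type*} (K : PreAbstractSimplicialComplex V)
    (P : K.faces → Prop) : List ℕ :=
  (List.range (complexDim K + 1)).map fun i =>
    {σ : K.faces | P σ ∧ σ.1.card = i + 1}.ncard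

/-- `σ` is a facet (a face of codimension one) of `τ`. -/
def IsCodimOne {V : Type*} {K : PreAbstractSimplicialComplex V} (σ τ : K.faces) : Prop :=
  σ.1 ⊂ τ.1 ∧ τ.1.card = σ.1.card + 1

/-- Discrete Morse functions in the sense of Forman. -/
structure IsDiscreteMorseFunction {V : Type*} {K : PreAbstractSimplicialComplex V}
    (f : K.faces → ℝ) : Prop where
  up : ∀ σ : K.faces, {τ : K.faces | IsCodimOne σ τ ∧ f τ ≤ f σ}.encard ≤ 1
  down : ∀ σ : K.faces, {ρ : K.faces | IsCodimOne ρ σ ∧ f σ ≤ f ρ}.encard ≤ 1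

/-- Critical faces of a discrete Morse function in the sense of Forman. -/
def IsFormanCritical {V : Type*} {K : PreAbstractSimplicialComplex V}
    (f : K.faces → ℝ) (σ : K.faces) : Prop :=
  (∀ τ : K.faces, IsCodimOne σ τ → f σ < f τ) ∧ (∀ ρ : K.faces, IsCodimOne ρ σ → f ρ < f σ)

/-- The set of all discrete Morse vectors of `K`. -/
def discreteMorseVectors {V : Type*} (K : PreAbstractSimplicialComplex V) : Set (List ℕ) :=
  {v | ∃ f : K.faces → ℝ, IsDiscreteMorseFunction f ∧ faceCountVector K (IsFormanCritical f) = v}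

/-- A discrete Morse vector is optimal if it minimizes the total number `c_0 + ⋯ + c_d` of
critical faces among all discrete Morse vectors of the complex. -/
def optimalDiscreteMorseVectors {V : Type*} (K : PreAbstractSimplicialComplex V) :
    Set (List ℕ) :=
  {v | v ∈ discreteMorseVectors K ∧ ∀ w ∈ discreteMorseVectors K, v.sum ≤ w.sum}

/-- `σ` is a free face of the set of faces `S`: it belongs to `S` and is properly contained in
exactly one member of `S`. -/
def IsFreeFace {V : Type*} (S : Set (Finset V)) (σ : Finset V) : Prop :=
  σ ∈ S ∧ ∃! τ, τ ∈ S ∧ σ ⊂ τ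

/-- Critical faces of a monotone discrete Morse function: no other face has the same value. -/
def IsLevelCritical {V : Type*} {K : PreAbstractSimplicialComplex V}
    (f : K.faces → ℤ) (δ : K.faces) : Prop :=
  ∀ σ : K.faces, σ ≠ δ → f σ ≠ f δ

/-- The sublevel complex of faces with value at most `q`. -/
def sublevelFaces {V : Type*} {K : PreAbstractSimplicialComplex V}
    (f : K.faces → ℤ) (q : ℤ) : Set (Finset V) :=
  {σ | ∃ h : σ ∈ K.faces, f ⟨σ, h⟩ ≤ q}

/-- Monotone discrete Morse functions. In `pairs_ordered` the inclusions are proper, so that the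
condition is about the matched pairs of faces. -/
structure IsMonotoneDiscreteMorseFunction {V : Type*} {K : PreAbstractSimplicialComplex V}
    (f : K.faces → ℤ) : Prop where
  monotone : ∀ σ τ : K.faces, σ.1 ⊆ τ.1 → f σ ≤ f τ
  fiber_card : ∀ q : ℤ, (f ⁻¹' {q}).encard ≤ 2
  fiber_comparable : ∀ σ τ : K.faces, f σ = f τ → σ.1 ⊆ τ.1 ∨ τ.1 ⊆ σ.1
  pairs_ordered : ∀ σ τ σ' τ' : K.faces, σ.1 ⊂ τ.1 → σ'.1 ⊂ τ'.1 →
    f σ = f τ → f σ' = f τ' → f τ ≤ f σ' → τ.1.card ≤ τ'.1.card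
  range_eq : ∃ M : ℕ, Set.range f = Set.Icc (0 : ℤ) (M : ℤ)
  no_free_face : ∀ δ : K.faces, IsLevelCritical f δ →
    ∀ σ : Finset V, σ.card + 1 = δ.1.card → ¬ IsFreeFace (sublevelFaces f (f δ)) σ

/-- The set of the discrete Morse vectors of all monotone discrete Morse functions on `K`. -/
def discreteMorseSpectrum {V : Type*} (K : PreAbstractSimplicialComplex V) : Set (List ℕ) :=
  {v | ∃ f : K.faces → ℤ, IsMonotoneDiscreteMorseFunction f ∧
    faceCountVector K (IsLevelCritical f) = v}

/-- The simplicial complex generated by a list of faces: all nonempty subsets of its members. -/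
def complexOfFacets {V : Type*} (L : List (Finset V)) : PreAbstractSimplicialComplex V where
  faces := {σ | σ.Nonempty ∧ ∃ F ∈ L, σ ⊆ F}
  isRelLowerSet_faces := by
    rintro σ ⟨hne, F, hF, hσ⟩
    exact ⟨hne, fun τ hτ hτne => ⟨hτne, F, hF, hτ.trans hσ⟩⟩

/-- The 2-dimensional facets: the 12 triangles of `Σ₂` other than `{1, 2, 3}`. -/
def sigmaTwoFacets : List (Finset ℕ) :=
  [{1, 3, 23}, {1, 22, 23}, {1, 22, 24}, {1, 22, 25}, {1, 24, 25}, {2, 3, 25},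
   {2, 22, 23}, {2, 22, 24}, {2, 22, 25}, {2, 23, 24}, {3, 23, 25}, {23, 24, 25}]

/-- The 114 tetrahedra of the modified complex `Σ₃'`. -/
def sigmaThreeModFacets : List (Finset ℕ) :=
  ([7, 8, 9, 10, 11, 12, 13].flatMap fun x =>
    [{1, 2, 5, x}, {1, 2, 6, x}, {1, 3, 5, x}, {1, 4, 6, x}, {2, 5, 6, x}, {3, 4, 6, x},
     {3, 5, 6, x},
     {1, 3, x, x + 7}, {1, 4, x, x + 7}, {3, 4, x, x + 7}, {1, 2, 4, x + 7},
     {2, 3, 4, x + 7}]) ++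
  [{2, 3, 14, 15}, {1, 2, 15, 16}, {1, 3, 16, 17}, {2, 3, 17, 18}, {1, 2, 18, 19},
   {1, 3, 14, 19},
   {1, 3, 15, 20}, {1, 2, 17, 20}, {2, 3, 19, 20},
   {1, 15, 16, 17}, {1, 15, 17, 20}, {2, 17, 18, 19}, {2, 17, 19, 20}, {3, 14, 15, 19},
   {3, 15, 19, 20}, {15, 17, 19, 20},
   {1, 2, 14, 21}, {1, 3, 18, 21}, {1, 14, 19, 21}, {1, 18, 19, 21}, {2, 3, 16, 21},
   {2, 14, 15, 21}, {2, 15, 16, 21},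
   {3, 16, 17, 21}, {3, 17, 18, 21}, {14, 15, 19, 21}, {15, 16, 17, 21}, {15, 17, 19, 21},
   {17, 18, 19, 21},
   {1, 2, 3, 21}]

/-- The 51 tetrahedra of a copy of `Σ₃` on the vertices `t₁, t₂, t₃, a, a + 1, …, a + 8`, whose
free face is the triangle `{t₁, t₂, t₃}`. -/
def sigmaThreeCopyFacets (t₁ t₂ t₃ a : ℕ) : List (Finset ℕ) :=
  ([1, 2, 3, 4, 5, 6, 7].flatMap fun k =>
    [{t₁, t₂, a, a + k}, {t₁, t₃, a, a + k}, {t₂, t₃, a, a + k}]) ++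
  [{t₂, t₃, a + 1, a + 2}, {t₁, t₂, a + 2, a + 3}, {t₁, t₃, a + 3, a + 4},
   {t₂, t₃, a + 4, a + 5}, {t₁, t₂, a + 5, a + 6}, {t₁, t₃, a + 6, a + 1},
   {t₁, t₃, a + 2, a + 7}, {t₁, t₂, a + 4, a + 7}, {t₂, t₃, a + 6, a + 7},
   {t₁, a + 2, a + 3, a + 4}, {t₁, a + 2, a + 4, a + 7},
   {t₂, a + 4, a + 5, a + 6}, {t₂, a + 4, a + 6, a + 7},
   {t₃, a + 1, a + 2, a + 6}, {t₃, a + 2, a + 6, a + 7},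
   {a + 2, a + 4, a + 6, a + 7},
   {t₁, t₂, t₃, a + 8},
   {t₁, t₂, a + 1, a + 8}, {t₁, t₃, a + 5, a + 8}, {t₂, t₃, a + 3, a + 8},
   {t₁, a + 1, a + 6, a + 8}, {t₁, a + 5, a + 6, a + 8},
   {t₂, a + 1, a + 2, a + 8}, {t₂, a + 2, a + 3, a + 8},
   {t₃, a + 3, a + 4, a + 8}, {t₃, a + 4, a + 5, a + 8},
   {a + 1, a + 2, a + 6, a + 8}, {a + 2, a + 3, a + 4, a + 8}, {a + 4, a + 5, a + 6, a + 8},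
   {a + 2, a + 4, a + 6, a + 8}]

/-- The 585 facets of `two_optima`: nine copies of `Σ₃` are glued to `Σ₂ ∪ Σ₃'`. -/
def twoOptimaFacets : List (Finset ℕ) :=
  sigmaTwoFacets ++ sigmaThreeModFacets ++
  sigmaThreeCopyFacets 1 2 5 26 ++ sigmaThreeCopyFacets 1 2 6 35 ++
  sigmaThreeCopyFacets 1 2 4 44 ++ sigmaThreeCopyFacets 1 3 5 53 ++
  sigmaThreeCopyFacets 1 4 6 62 ++ sigmaThreeCopyFacets 2 3 4 71 ++
  sigmaThreeCopyFacets 2 5 6 80 ++ sigmaThreeCopyFacets 3 4 6 89 ++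
  sigmaThreeCopyFacets 3 5 6 98

/-- The 3-dimensional simplicial complex `two_optima`, with vertices `1, …, 106`. -/
def twoOptima : PreAbstractSimplicialComplex ℕ := complexOfFacets twoOptimaFacets

/-! Existence, the monotone obstruction and optimality rest on three separate arguments.

Existence: an explicit list removes all faces of the complex in pairs of codimension one, except for
`{1, 2, 3, 21}`, `{1, 2, 44}` and `{24}`, which are removed alone. Negated removal time is a
discrete Morse function with just these critical faces
(`IsRemovalOrder.exists_isDiscreteMorseFunction`), so its vector is `(1, 0, 1, 1)`.

Monotone functions: the triangle `{1, 2, 3}` lies in no tetrahedron but `{1, 2, 3, 21}`. Together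
with the removal order this shows that every nonempty set of tetrahedra has a triangle lying in
exactly one of them (`exists_triangle_in_unique_tetrahedron`). A critical tetrahedron would
therefore see a free triangle in its sublevel complex, which condition 6 forbids; hence `c_3 = 0`.

Optimality: every discrete Morse function has a critical vertex, and its number of critical faces
has a fixed parity, which the function above shows to be odd. It remains to find a critical face of
dimension at least two (`exists_critical_of_two_lt_card`), as this gives two critical faces and
hence three. Suppose there is none. In each copy of `Σ₃` the tetrahedron of largest value must be
matched with the glueing triangle. Following the matching downwards replaces the glueing triangle by
a homologous mod 2 chain of triangles in the copy that are not matched upwards. These chains and the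
twelve triangles of `Σ₂` form a set in which every edge of a triangle lies in another triangle. But
the triangle of largest value in this set is matched with an edge, and any other triangle at that
edge has a still larger value (`IsMorseOn.false_of_regions`). -/

variable {V : Type*}

/-! ### Removal orders and the discrete Morse functions they define. -/

/-- A list of pairs of faces is a removal order if no pair removed later has a face containing a
face of a pair removed earlier. -/
def IsRemovalOrder (L : List (Finset V × Finset V)) : Prop :=
  L.Pairwise fun p q => ¬ p.1 ⊆ q.2

/-- If `σ` were removed before `τ`, then `L[i].1 ⊆ σ ⊆ τ ⊆ L[j].2` would violate the order. Taking
`σ = τ` shows that a face occurs in only one pair. -/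
theorem IsRemovalOrder.index_le {L : List (Finset V × Finset V)} (hL : IsRemovalOrder L)
    (hsub : ∀ p ∈ L, p.1 ⊆ p.2) {i j : ℕ} (hi : i < L.length) (hj : j < L.length)
    {σ τ : Finset V} (hσ : σ = L[i].1 ∨ σ = L[i].2) (hτ : τ = L[j].1 ∨ τ = L[j].2)
    (h : σ ⊆ τ) : j ≤ i := by
  by_contra! hij
  have h1 := List.pairwise_iff_getElem.1 hL i j hi hj hij
  have h2 : L[i].1 ⊆ σ := by
    rcases hσ with rfl | rfl
    · exact subset_rfl
    · exact hsub _ (List.getElem_mem hi)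
  have h3 : τ ⊆ L[j].2 := by
    rcases hτ with rfl | rfl
    · exact hsub _ (List.getElem_mem hj)
    · exact subset_rfl
  exact h1 (h2.trans (h.trans h3))

/-- A removal order with pairs of codimension at most one gives a discrete Morse function, whose
critical faces are those removed on their own. -/
theorem IsRemovalOrder.exists_isDiscreteMorseFunction {K : PreAbstractSimplicialComplex V}
    {L : List (Finset V × Finset V)} (hL : IsRemovalOrder L)
    (hsub : ∀ p ∈ L, p.1 ⊆ p.2 ∧ p.2.card ≤ p.1.card + 1)
    (hmem : ∀ σ, σ ∈ K.faces ↔ ∃ p ∈ L, σ = p.1 ∨ σ = p.2) :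
    ∃ f : K.faces → ℝ, IsDiscreteMorseFunction f ∧
      ∀ σ : K.faces, IsFormanCritical f σ ↔ (σ.1, σ.1) ∈ L := by
  have hex : ∀ σ : K.faces, ∃ i : ℕ, ∃ hi : i < L.length, σ.1 = L[i].1 ∨ σ.1 = L[i].2 := by
    intro σ
    obtain ⟨p, hp, h⟩ := (hmem σ.1).1 σ.2
    obtain ⟨i, hi, rfl⟩ := List.getElem_of_mem hp
    exact ⟨i, hi, h⟩
  choose idx hlt hidx using hex
  have hle : ∀ σ τ : K.faces, σ.1 ⊆ τ.1 → idx τ ≤ idx σ := fun σ τ h =>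
    hL.index_le (fun p hp => (hsub p hp).1) (hlt σ) (hlt τ) (hidx σ) (hidx τ) h
  have hpair : ∀ σ τ : K.faces, IsCodimOne σ τ → idx σ ≤ idx τ →
      σ.1 = (L[idx σ]'(hlt σ)).1 ∧ τ.1 = (L[idx σ]'(hlt σ)).2 ∧
      σ.1 = (L[idx τ]'(hlt τ)).1 ∧ τ.1 = (L[idx τ]'(hlt τ)).2 := by
    intro σ τ hστ h
    have he : idx τ = idx σ := le_antisymm (hle σ τ hστ.1.subset) h
    have h1 := hidx σ
    have h2 := hidx τ
    have h3 := (hsub _ (List.getElem_mem (hlt σ))).1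
    simp only [he] at h2 ⊢
    rcases h1 with h1 | h1 <;> rcases h2 with h2 | h2
    · exact absurd (h1.trans h2.symm) hστ.1.ne
    · exact ⟨h1, h2, h1, h2⟩
    · rw [← h1, ← h2] at h3
      exact absurd (hστ.1.trans_subset h3) (ssubset_irrefl _)
    · exact absurd (h1.trans h2.symm) hστ.1.ne
  -- The two members of a pair share a value; in any other codimension-one inclusion the larger face
  -- is removed strictly earlier and so has the larger value.
  refine ⟨fun σ => -(idx σ : ℝ), ⟨fun σ => ?_, fun σ => ?_⟩, fun σ => ?_⟩
  · rw [Set.encard_le_one_iff]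
    rintro τ τ' ⟨h1, h2⟩ ⟨h3, h4⟩
    simp only [neg_le_neg_iff, Nat.cast_le] at h2 h4
    exact Subtype.ext ((hpair _ _ h1 h2).2.1.trans (hpair _ _ h3 h4).2.1.symm)
  · rw [Set.encard_le_one_iff]
    rintro τ τ' ⟨h1, h2⟩ ⟨h3, h4⟩
    simp only [neg_le_neg_iff, Nat.cast_le] at h2 h4
    exact Subtype.ext ((hpair _ _ h1 h2).2.2.1.trans (hpair _ _ h3 h4).2.2.1.symm)
  · simp only [IsFormanCritical, neg_lt_neg_iff, Nat.cast_lt]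
    constructor
    · rintro ⟨hup, hdown⟩
      set p := L[idx σ]'(hlt σ) with hp
      have hpL : p ∈ L := List.getElem_mem _
      have hσ : σ.1 = p.1 ∨ σ.1 = p.2 := hidx σ
      by_cases hpp : p.1 = p.2
      · have : p = (σ.1, σ.1) := by
          ext1
          · rcases hσ with h | h
            · exact h.symm
            · exact hpp.trans h.symm
          · rcases hσ with h | h
            · exact hpp.symm.trans h.symm
            · exact h.symm
        rwa [this] at hpL
      · exfalso
        have hf1 : p.1 ∈ K.faces := (hmem _).2 ⟨p, hpL, Or.inl rfl⟩
        have hf2 : p.2 ∈ K.faces := (hmem _).2 ⟨p, hpL, Or.inr rfl⟩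
        have hss : p.1 ⊂ p.2 := (hsub p hpL).1.ssubset_of_ne hpp
        have hc : IsCodimOne (⟨p.1, hf1⟩ : K.faces) ⟨p.2, hf2⟩ :=
          ⟨hss, le_antisymm (hsub p hpL).2 (Finset.card_lt_card hss)⟩
        have hle' : ∀ ρ : K.faces, ρ.1 = p.1 ∨ ρ.1 = p.2 → idx ρ = idx σ := fun ρ hρ =>
          le_antisymm
            (hL.index_le (fun p hp => (hsub p hp).1) (hlt σ) (hlt ρ) hρ (hidx ρ) subset_rfl)
            (hL.index_le (fun p hp => (hsub p hp).1) (hlt ρ) (hlt σ) (hidx ρ) hρ subset_rfl)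
        rcases hσ with h | h
        · have he : (⟨p.1, hf1⟩ : K.faces) = σ := Subtype.ext h.symm
          rw [he] at hc
          exact absurd (hle' ⟨p.2, hf2⟩ (Or.inr rfl)) (hup _ hc).ne
        · have he : (⟨p.2, hf2⟩ : K.faces) = σ := Subtype.ext h.symm
          rw [he] at hc
          exact absurd (hle' ⟨p.1, hf1⟩ (Or.inl rfl)) (hdown _ hc).ne'
    · intro h
      obtain ⟨i, hi, hLi⟩ := List.getElem_of_mem h
      have hi' : idx σ = i := le_antisymm
        (hL.index_le (fun p hp => (hsub p hp).1) hi (hlt σ) (σ := σ.1) (Or.inl (by rw [hLi]))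
          (hidx σ) subset_rfl)
        (hL.index_le (fun p hp => (hsub p hp).1) (hlt σ) hi (hidx σ) (τ := σ.1)
          (Or.inl (by rw [hLi])) subset_rfl)
      subst hi'
      constructor
      · intro τ hc
        by_contra! hge
        have := hpair _ _ hc hge
        rw [hLi] at this
        exact hc.1.ne this.2.1.symm
      · intro ρ hc
        by_contra! hge
        have := hpair _ _ hc hge
        rw [hLi] at this
        exact hc.1.ne this.2.2.1

/-- The earliest pair whose larger member is in `S` works: every other member of `S` is removed
later and so cannot contain the smaller member of this pair. -/
theorem IsRemovalOrder.exists_maximal {L : List (Finset V × Finset V)} (hL : IsRemovalOrder L)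
    (hsub : ∀ p ∈ L, p.1 ⊆ p.2) {S : Set (Finset V)} (hne : S.Nonempty)
    (hS : ∀ τ ∈ S, ∃ p ∈ L, p.2 = τ) :
    ∃ p ∈ L, p.2 ∈ S ∧ ∀ τ ∈ S, p.1 ⊆ τ → τ = p.2 := by
  induction L with
  | nil =>
    obtain ⟨τ, hτ⟩ := hne
    simpa using hS τ hτ
  | cons p L ih =>
    have hL' := List.pairwise_cons.1 hL
    by_cases hp : p.2 ∈ S
    · refine ⟨p, by simp, hp, fun τ hτ h => ?_⟩
      obtain ⟨q, hq, rfl⟩ := hS τ hτ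
      rcases List.mem_cons.1 hq with rfl | hq
      · rfl
      · exact absurd h (hL'.1 q hq)
    · obtain ⟨q, hq, h⟩ := ih hL'.2 (fun q hq => hsub q (by simp [hq])) (fun τ hτ => by
        obtain ⟨q, hq, rfl⟩ := hS τ hτ
        rcases List.mem_cons.1 hq with rfl | hq
        · exact absurd hτ hp
        · exact ⟨q, hq, rfl⟩)
      exact ⟨q, by simp [hq], h⟩

/-! ### Forman's matching: parity of the number of critical faces and existence of a critical
vertex. -/

section Forman

variable {K : PreAbstractSimplicialComplex V} {f : K.faces → ℝ}

/-- The pairs of faces matched by a discrete Morse function. -/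
def IsMatched (f : K.faces → ℝ) (σ τ : K.faces) : Prop := IsCodimOne σ τ ∧ f τ ≤ f σ

theorem isFormanCritical_iff {σ : K.faces} :
    IsFormanCritical f σ ↔ (∀ τ, ¬ IsMatched f σ τ) ∧ ∀ ρ, ¬ IsMatched f ρ σ := by
  simp [IsFormanCritical, IsMatched]

theorem IsDiscreteMorseFunction.matched_unique_right (hf : IsDiscreteMorseFunction f)
    {σ τ τ' : K.faces} (h : IsMatched f σ τ) (h' : IsMatched f σ τ') : τ = τ' :=
  Set.encard_le_one_iff.1 (hf.up σ) _ _ h h'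

theorem IsDiscreteMorseFunction.matched_unique_left (hf : IsDiscreteMorseFunction f)
    {ρ ρ' σ : K.faces} (h : IsMatched f ρ σ) (h' : IsMatched f ρ' σ) : ρ = ρ' :=
  Set.encard_le_one_iff.1 (hf.down σ) _ _ h h'

theorem IsDiscreteMorseFunction.lt_of_matched_up (hf : IsDiscreteMorseFunction f)
    {σ τ τ' : K.faces} (h : IsMatched f σ τ) (h' : IsCodimOne σ τ') (hne : τ' ≠ τ) :
    f σ < f τ' := by
  by_contra! hle
  exact hne (hf.matched_unique_right ⟨h', hle⟩ h)

theorem IsDiscreteMorseFunction.lt_of_matched_down (hf : IsDiscreteMorseFunction f)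
    {ρ ρ' σ : K.faces} (h : IsMatched f ρ σ) (h' : IsCodimOne ρ' σ) (hne : ρ' ≠ ρ) :
    f ρ' < f σ := by
  by_contra! hle
  exact hne (hf.matched_unique_left ⟨h', hle⟩ h)

/-- Forman's lemma: a face is not matched both upwards and downwards. -/
theorem IsDiscreteMorseFunction.not_matched_twice (hf : IsDiscreteMorseFunction f)
    {ρ σ τ : K.faces} (h : IsMatched f ρ σ) (h' : IsMatched f σ τ) : False := by
  classical
  have hcard : (τ.1 \ σ.1).card = 1 := by
    rw [Finset.card_sdiff_of_subset h'.1.1.subset, h'.1.2]; omega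
  obtain ⟨w, hw⟩ := Finset.card_eq_one.1 hcard
  have hw' : w ∈ τ.1 ∧ w ∉ σ.1 := by
    rw [← Finset.mem_sdiff, hw]; simp
  have hwρ : w ∉ ρ.1 := fun h1 => hw'.2 (h.1.1.subset h1)
  -- The second face `ρ ∪ {w}` between `ρ` and `τ` gives the contradiction `f ρ < f (ρ ∪ {w}) < f τ
  -- ≤ f σ ≤ f ρ`.
  have hsub : insert w ρ.1 ⊆ τ.1 :=
    Finset.insert_subset hw'.1 (h.1.1.subset.trans h'.1.1.subset)
  have hmem : insert w ρ.1 ∈ K.faces :=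
    (K.isRelLowerSet_faces τ.2).2 hsub (Finset.insert_nonempty _ _)
  have hc1 : IsCodimOne ρ ⟨insert w ρ.1, hmem⟩ :=
    ⟨Finset.ssubset_insert hwρ, Finset.card_insert_of_notMem hwρ⟩
  have hcardτ : τ.1.card = (insert w ρ.1).card + 1 := by
    rw [Finset.card_insert_of_notMem hwρ, h'.1.2, h.1.2]
  have hc2 : IsCodimOne ⟨insert w ρ.1, hmem⟩ τ := by
    refine ⟨hsub.ssubset_of_ne fun he => ?_, hcardτ⟩
    rw [he] at hcardτ
    omega
  have hne : (⟨insert w ρ.1, hmem⟩ : K.faces) ≠ σ := by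
    rintro rfl
    exact hw'.2 (Finset.mem_insert_self _ _)
  have h1 := hf.lt_of_matched_up h hc1 hne
  have h2 := hf.lt_of_matched_down h' hc2 hne
  have h3 := h.2
  have h4 := h'.2
  linarith

/-- The number of critical faces has the parity of the number of faces. -/
theorem IsDiscreteMorseFunction.ncard_critical_mod_two [Finite K.faces]
    (hf : IsDiscreteMorseFunction f) :
    {σ | IsFormanCritical f σ}.ncard ≡ Nat.card K.faces [MOD 2] := by
  classical
  have := Fintype.ofFinite K.faces
  have hex : ∀ σ : K.faces, ¬ IsFormanCritical f σ → ∃ τ, IsMatched f σ τ ∨ IsMatched f τ σ := by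
    intro σ h
    rw [isFormanCritical_iff] at h
    push Not at h
    by_cases h1 : ∃ τ, IsMatched f σ τ
    · exact h1.imp fun _ => Or.inl
    · push Not at h1
      exact (h h1).imp fun _ => Or.inr
  choose p hp using hex
  have huniq : ∀ σ τ τ' : K.faces, IsMatched f σ τ ∨ IsMatched f τ σ →
      IsMatched f σ τ' ∨ IsMatched f τ' σ → τ = τ' := by
    rintro σ τ τ' (h | h) (h' | h')
    · exact hf.matched_unique_right h h'
    · exact (hf.not_matched_twice h' h).elim
    · exact (hf.not_matched_twice h h').elim
    · exact hf.matched_unique_left h h'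
  have hcrit : ∀ σ h, ¬ IsFormanCritical f (p σ h) := by
    intro σ h hc
    rw [isFormanCritical_iff] at hc
    rcases hp σ h with h1 | h1
    · exact hc.2 _ h1
    · exact hc.1 _ h1
  -- Exchanging matched partners is an involution without fixed points on the noncritical faces, so
  -- their number is even.
  have key : ∑ σ ∈ Finset.univ.filter (fun σ : K.faces => ¬ IsFormanCritical f σ), (1 : ZMod 2)
      = 0 := by
    refine Finset.sum_involution (fun σ h => p σ (Finset.mem_filter.1 h).2) ?_ ?_ ?_ ?_
    · intros; decide
    · intro σ h _ he
      have := hp σ (Finset.mem_filter.1 h).2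
      rw [he] at this
      rcases this with h | h <;> exact h.1.1.ne rfl
    · intro σ h
      simpa using hcrit σ _
    · intro σ h
      exact huniq (p σ (Finset.mem_filter.1 h).2) _ _ (hp _ _) (hp σ _).symm
  rw [← ZMod.natCast_eq_natCast_iff, Nat.card_eq_fintype_card, Set.ncard_eq_toFinset_card',
    ← Finset.card_univ,
    ← Finset.card_filter_add_card_filter_not (s := Finset.univ) (fun σ => IsFormanCritical f σ)]
  simp only [Finset.sum_const, nsmul_eq_mul, mul_one] at key
  rw [Nat.cast_add, key, add_zero, Set.toFinset_ofPred]

/-- A discrete Morse function on a nonempty finite complex has a critical vertex. -/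
theorem IsDiscreteMorseFunction.exists_critical_vertex [Finite K.faces] [Nonempty K.faces]
    (hf : IsDiscreteMorseFunction f) : ∃ σ, IsFormanCritical f σ ∧ σ.1.card = 1 := by
  classical
  have hvert : ∀ σ : K.faces, ∀ v ∈ σ.1, {v} ∈ K.faces := fun σ v hv =>
    (K.isRelLowerSet_faces σ.2).2 (Finset.singleton_subset_iff.2 hv) (Finset.singleton_nonempty v)
  obtain ⟨σ₀⟩ := ‹Nonempty K.faces›
  obtain ⟨v₀, hv₀⟩ : σ₀.1.Nonempty := (K.isRelLowerSet_faces σ₀.2).1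
  -- A vertex of least value is critical: if it were matched with an edge, the other end of that
  -- edge would have a smaller value.
  obtain ⟨σ, hσ, hmin⟩ := Set.exists_min_image {σ : K.faces | σ.1.card = 1} f (Set.toFinite _)
    ⟨⟨{v₀}, hvert _ _ hv₀⟩, by simp⟩
  refine ⟨σ, isFormanCritical_iff.2 ⟨fun τ h => ?_, fun ρ h => ?_⟩, hσ⟩
  · have hc : (τ.1 \ σ.1).card = 1 := by
      rw [Finset.card_sdiff_of_subset h.1.1.subset, h.1.2]; omega
    obtain ⟨w, hw⟩ := Finset.card_eq_one.1 hc
    have hw' : w ∈ τ.1 ∧ w ∉ σ.1 := by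
      rw [← Finset.mem_sdiff, hw]; simp
    have hσ' : σ.1.card = 1 := hσ
    have hwτ : IsCodimOne ⟨{w}, hvert _ _ hw'.1⟩ τ := by
      have hcw : τ.1.card = ({w} : Finset V).card + 1 := by rw [h.1.2, hσ']; simp
      refine ⟨(Finset.singleton_subset_iff.2 hw'.1).ssubset_of_ne fun he => ?_, hcw⟩
      rw [he] at hcw
      omega
    have hne : (⟨{w}, hvert _ _ hw'.1⟩ : K.faces) ≠ σ := by
      intro he
      apply hw'.2
      rw [← he]
      exact Finset.mem_singleton_self w
    have h1 := hf.lt_of_matched_down h hwτ hne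
    have h2 := hmin ⟨{w}, hvert _ _ hw'.1⟩ (by simp)
    have h3 := h.2
    linarith
  · have h1 := h.1.2
    have h2 : σ.1.card = 1 := hσ
    have h3 := (K.isRelLowerSet_faces ρ.2).1.card_pos
    omega

end Forman

theorem sum_faceCountVector (K : PreAbstractSimplicialComplex V) [Finite K.faces]
    (P : K.faces → Prop) : (faceCountVector K P).sum = {σ | P σ}.ncard := by
  classical
  have := Fintype.ofFinite K.faces
  -- The bound matters: an unbounded set of natural numbers has `sSup` equal to `0`.
  have hbdd : BddAbove {k : ℕ | ∃ σ ∈ K.faces, σ.card = k + 1} := by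
    refine ⟨∑ σ : K.faces, σ.1.card, ?_⟩
    rintro k ⟨σ, hσ, hk⟩
    have := Finset.single_le_sum (f := fun σ : K.faces => σ.1.card) (fun _ _ => Nat.zero_le _)
      (Finset.mem_univ ⟨σ, hσ⟩)
    simp only at this
    omega
  have hlt : ∀ σ : K.faces, σ.1.card - 1 ∈ Finset.range (complexDim K + 1) := by
    intro σ
    have h0 := (K.isRelLowerSet_faces σ.2).1.card_pos
    rw [Finset.mem_range, Nat.lt_succ_iff]
    exact le_csSup hbdd ⟨σ.1, σ.2, by omega⟩
  have hsum : ∀ n (g : ℕ → ℕ), ((List.range n).map g).sum = ∑ i ∈ Finset.range n, g i := by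
    intro n g
    induction n with
    | zero => simp
    | succ n ih => rw [List.sum_range_succ, Finset.sum_range_succ, ih]
  rw [faceCountVector, hsum, Set.ncard_eq_toFinset_card',
    Finset.card_eq_sum_card_fiberwise (f := fun σ : K.faces => σ.1.card - 1)
      (fun σ _ => hlt σ)]
  refine Finset.sum_congr rfl fun i _ => ?_
  rw [Set.ncard_eq_toFinset_card']
  congr 1
  ext σ
  have h0 := (K.isRelLowerSet_faces σ.2).1.card_pos
  simp only [Set.mem_toFinset, Set.mem_ofPred_eq, Finset.mem_filter]
  exact and_congr_right fun _ => by omega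

/-! ### Mod 2 chains of triangles as an obstruction to having no critical faces of dimension at
least two. -/

section Chains

variable {V : Type*} [DecidableEq V]

/-- The defining property of a discrete Morse function, for a function on all finite sets that is
regarded as a function on the faces in `F`. -/
structure IsMorseOn (F : Set (Finset V)) (g : Finset V → ℝ) : Prop where
  lt_of_le_up : ∀ σ ∈ F, ∀ τ ∈ F, ∀ τ' ∈ F, σ ⊆ τ → τ.card = σ.card + 1 → σ ⊆ τ' →
    τ'.card = σ.card + 1 → τ' ≠ τ → g τ ≤ g σ → g σ < g τ'
  lt_of_le_down : ∀ ρ ∈ F, ∀ ρ' ∈ F, ∀ σ ∈ F, ρ ⊆ σ → σ.card = ρ.card + 1 → ρ' ⊆ σ →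
    σ.card = ρ'.card + 1 → ρ' ≠ ρ → g σ ≤ g ρ → g ρ' < g σ

/-- The 2-dimensional faces of the members of `R`, if these are 3-dimensional. -/
def boundaryFaces (R : Finset (Finset V)) : Finset (Finset V) :=
  R.biUnion fun T => T.image T.erase

theorem mem_boundaryFaces {R : Finset (Finset V)} {t : Finset V} :
    t ∈ boundaryFaces R ↔ ∃ T ∈ R, ∃ v ∈ T, T.erase v = t := by
  simp [boundaryFaces]

/-- Modulo two, the boundary of the boundary of a tetrahedron vanishes. -/
theorem sum_erase_subset_eq_zero {T e : Finset V} (hT : T.card = 4) (he : e.card = 2) :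
    ∑ v ∈ T, (if e ⊆ T.erase v then 1 else 0 : ZMod 2) = 0 := by
  by_cases h : e ⊆ T
  · have h1 : ∀ v ∈ T, (if e ⊆ T.erase v then 1 else 0 : ZMod 2) = if v ∉ e then 1 else 0 := by
      intro v _
      simp only [Finset.subset_erase, h, true_and]
    rw [Finset.sum_congr rfl h1, ← Finset.sum_filter, Finset.filter_notMem_eq_sdiff,
      Finset.sum_const, Finset.card_sdiff_of_subset h, hT, he]
    decide
  · refine Finset.sum_eq_zero fun v _ => if_neg fun h' => h (h'.trans (Finset.erase_subset v T))

/-- In a region `R` of tetrahedra all of which are matched downwards, and whose triangles other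
than `t₀` are interior to the region, the triangle `t₀` is homologous modulo two to a chain of
triangles that are not matched upwards. -/
theorem IsMorseOn.exists_chain {F : Set (Finset V)} {g : Finset V → ℝ} (hg : IsMorseOn F g)
    {R : Finset (Finset V)} {t₀ : Finset V} (hne : R.Nonempty)
    (hF : ∀ T ∈ R, ∀ v ∈ T, T.erase v ∈ F) (hRF : ∀ T ∈ R, T ∈ F) (hcard : ∀ T ∈ R, T.card = 4)
    (hmatch : ∀ T ∈ R, ∃ v ∈ T, g T ≤ g (T.erase v))
    (hint : ∀ T ∈ R, ∀ v ∈ T, T.erase v ≠ t₀ → ∃ T' ∈ R, T' ≠ T ∧ T.erase v ⊆ T')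
    (hclosed : ∀ T ∈ R, ∀ v ∈ T, T.erase v ≠ t₀ → ∀ T' ∈ F, T'.card = 4 → T.erase v ⊆ T' →
      T' ∈ R) :
    ∃ c : Finset V → ZMod 2,
      (∀ t, c t ≠ 0 → t ≠ t₀ ∧ t ∈ boundaryFaces R ∧
        ∀ T ∈ F, T.card = 4 → t ⊆ T → g t < g T) ∧
      ∀ e : Finset V, e.card = 2 →
        ∑ t ∈ boundaryFaces R with e ⊆ t, c t = if e ⊆ t₀ then 1 else 0 := by
  have hcard3 : ∀ T ∈ R, ∀ v ∈ T, (T.erase v).card + 1 = 4 := fun T hT v hv => by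
    rw [Finset.card_erase_add_one hv, hcard T hT]
  -- the free triangle of the region is matched upwards
  obtain ⟨T₀, hT₀, hmax⟩ := R.exists_max_image g hne
  obtain ⟨v₀, hv₀, hle₀⟩ := hmatch T₀ hT₀
  have he₀ : T₀.erase v₀ = t₀ := by
    -- Otherwise a second tetrahedron of the region contains the matched triangle, and it has a
    -- larger value than `T₀`.
    by_contra hne
    obtain ⟨T', hT', hne', hsub⟩ := hint T₀ hT₀ v₀ hv₀ hne
    have := hg.lt_of_le_up _ (hF _ hT₀ _ hv₀) _ (hRF _ hT₀) _ (hRF _ hT')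
      (Finset.erase_subset _ _) (by rw [hcard3 _ hT₀ _ hv₀, hcard _ hT₀]) hsub
      (by rw [hcard3 _ hT₀ _ hv₀, hcard _ hT']) hne' hle₀
    linarith [hmax T' hT']
  -- a matched triangle of the region is matched with a tetrahedron of the region
  have hmatched : ∀ t ∈ boundaryFaces R, ∀ T ∈ F, T.card = 4 → t ⊆ T → g T ≤ g t → T ∈ R := by
    intro t ht T hT hT4 hsub hle
    obtain ⟨T', hT', v, hv, rfl⟩ := mem_boundaryFaces.1 ht
    -- The triangle `t₀` may lie in tetrahedra outside the region, but its unique partner is already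
    -- `T₀`.
    by_cases h : T'.erase v = t₀
    · by_contra hTR
      have hTT : T ≠ T₀ := fun h => hTR (h ▸ hT₀)
      rw [h, ← he₀] at hsub hle
      have := hg.lt_of_le_up _ (hF _ hT₀ _ hv₀) _ (hRF _ hT₀) _ hT
        (Finset.erase_subset _ _) (by rw [hcard3 _ hT₀ _ hv₀, hcard _ hT₀]) hsub
        (by rw [hcard3 _ hT₀ _ hv₀, hT4]) hTT hle₀
      linarith
    · exact hclosed T' hT' v hv h T hT hT4 hsub
  -- Gradient flow, by induction on the number of triangles of the region with smaller value: a
  -- triangle matched upwards is replaced by the other three triangles of its partner, which have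
  -- smaller values and the same boundary mod 2.
  have key : ∀ n : ℕ, ∀ t ∈ boundaryFaces R, ((boundaryFaces R).filter (g · < g t)).card = n →
      ∃ c : Finset V → ZMod 2,
        (∀ t, c t ≠ 0 → t ∈ boundaryFaces R ∧ ∀ T ∈ F, T.card = 4 → t ⊆ T → g t < g T) ∧
        ∀ e : Finset V, e.card = 2 →
          ∑ t ∈ boundaryFaces R with e ⊆ t, c t = if e ⊆ t then 1 else 0 := by
    intro n
    induction n using Nat.strong_induction_on with
    | _ n ih =>
      intro t ht hn
      by_cases hup : ∀ T ∈ F, T.card = 4 → t ⊆ T → g t < g T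
      · refine ⟨fun s => if s = t then 1 else 0, fun s hs => ?_, fun e _ => ?_⟩
        · obtain rfl : s = t := by
            by_contra h
            exact hs (if_neg h)
          exact ⟨ht, hup⟩
        · rw [Finset.sum_ite_eq']
          simp [ht]
      · push Not at hup
        obtain ⟨T, hT, hT4, hsub, hle⟩ := hup
        have hTR := hmatched t ht T hT hT4 hsub hle
        obtain ⟨T', hT', v', hv', rfl⟩ := mem_boundaryFaces.1 ht
        have hc3 := hcard3 _ hT' _ hv'
        obtain ⟨w, hw, hwt⟩ : ∃ w ∈ T, T.erase w = T'.erase v' := by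
          have h1 : (T \ T'.erase v').card = 1 := by
            rw [Finset.card_sdiff_of_subset hsub]; omega
          obtain ⟨w, hw⟩ := Finset.card_eq_one.1 h1
          have hwm : w ∈ T ∧ w ∉ T'.erase v' := by
            rw [← Finset.mem_sdiff, hw]; simp
          refine ⟨w, hwm.1, (Finset.eq_of_subset_of_card_le
            (Finset.subset_erase.2 ⟨hsub, hwm.2⟩) ?_).symm⟩
          have := hcard3 _ hTR _ hwm.1
          omega
        rw [← hwt] at hn ht hle ⊢
        have hlt : ∀ v ∈ T.erase w, g (T.erase v) < g (T.erase w) := by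
          intro v hv
          have hv' := Finset.mem_of_mem_erase hv
          have := hg.lt_of_le_down _ (hF _ hTR _ hw) _ (hF _ hTR _ hv') _ hT
            (Finset.erase_subset _ _) (by rw [hcard3 _ hTR _ hw, hT4])
            (Finset.erase_subset _ _) (by rw [hcard3 _ hTR _ hv', hT4])
            (fun h => (Finset.mem_erase.1 hv).1 ((Finset.erase_inj T hv').1 h)) hle
          linarith
        have hex : ∀ v : V, ∃ c : Finset V → ZMod 2, v ∈ T.erase w →
            (∀ t, c t ≠ 0 → t ∈ boundaryFaces R ∧ ∀ T ∈ F, T.card = 4 → t ⊆ T → g t < g T) ∧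
            ∀ e : Finset V, e.card = 2 → ∑ t ∈ boundaryFaces R with e ⊆ t, c t =
              if e ⊆ T.erase v then 1 else 0 := by
          intro v
          by_cases hv : v ∈ T.erase w
          · have hmem : T.erase v ∈ boundaryFaces R :=
              mem_boundaryFaces.2 ⟨T, hTR, v, Finset.mem_of_mem_erase hv, rfl⟩
            obtain ⟨c, hc⟩ := ih _ (by
              rw [← hn]
              refine Finset.card_lt_card (Finset.ssubset_iff_of_subset ?_ |>.2
                ⟨T.erase v, by simp [hmem, hlt v hv], by simp⟩)
              intro s hs
              rw [Finset.mem_filter] at hs ⊢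
              exact ⟨hs.1, hs.2.trans (hlt v hv)⟩) (T.erase v) hmem rfl
            exact ⟨c, fun _ => hc⟩
          · exact ⟨0, fun h => absurd h hv⟩
        choose c hc using hex
        refine ⟨fun s => ∑ v ∈ T.erase w, c v s, fun s hs => ?_, fun e he => ?_⟩
        · obtain ⟨v, hv, hvs⟩ := Finset.exists_ne_zero_of_sum_ne_zero hs
          exact (hc v hv).1 s hvs
        · rw [Finset.sum_comm, Finset.sum_congr rfl fun v hv => (hc v hv).2 e he]
          have h0 := sum_erase_subset_eq_zero hT4 he
          rw [← Finset.add_sum_erase _ _ hw] at h0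
          rw [eq_neg_of_add_eq_zero_right h0, ZMod.neg_eq_self_mod_two]
  have ht₀ : t₀ ∈ boundaryFaces R := mem_boundaryFaces.2 ⟨T₀, hT₀, v₀, hv₀, he₀⟩
  obtain ⟨c, hc1, hc2⟩ := key _ t₀ ht₀ rfl
  refine ⟨c, fun t ht => ⟨?_, hc1 t ht⟩, hc2⟩
  rintro rfl
  have := (hc1 _ ht).2 T₀ (hRF _ hT₀) (hcard _ hT₀) (he₀ ▸ Finset.erase_subset _ _)
  rw [he₀] at hle₀
  linarith

/-- The regions `R i` with glueing triangles `t i`, and the triangles in `P`, obstruct a discrete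
Morse function without critical faces of dimension at least two, if no edge of the triangles
`t i` and of those in `P` is an edge of only one of them. -/
theorem IsMorseOn.false_of_regions {ι : Type*} {F : Set (Finset V)} {g : Finset V → ℝ}
    (hg : IsMorseOn F g) (hFfin : F.Finite)
    (hdown : ∀ τ ∈ F, ∀ σ ⊆ τ, σ.Nonempty → σ ∈ F)
    (hmatch4 : ∀ T ∈ F, T.card = 4 → ∃ v ∈ T, g T ≤ g (T.erase v))
    (hmatch3 : ∀ t ∈ F, t.card = 3 → (∀ T ∈ F, T.card = 4 → t ⊆ T → g t < g T) →
      ∃ v ∈ t, g t ≤ g (t.erase v))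
    {R : ι → Finset (Finset V)} {t : ι → Finset V} {P : Set (Finset V)}
    (hne : ∀ i, (R i).Nonempty) (hRF : ∀ i, ∀ T ∈ R i, T ∈ F) (hcard : ∀ i, ∀ T ∈ R i, T.card = 4)
    (hint : ∀ i, ∀ T ∈ R i, ∀ v ∈ T, T.erase v ≠ t i → ∃ T' ∈ R i, T' ≠ T ∧ T.erase v ⊆ T')
    (hclosed : ∀ i, ∀ T ∈ R i, ∀ v ∈ T, T.erase v ≠ t i → ∀ T' ∈ F, T'.card = 4 →
      T.erase v ⊆ T' → T' ∈ R i)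
    (hdisj : ∀ i j, i ≠ j → ∀ T ∈ R i, T ∉ R j)
    (hPne : P.Nonempty) (hPF : ∀ s ∈ P, s ∈ F ∧ s.card = 3)
    (hP : ∀ s ∈ P, ∀ T ∈ F, T.card = 4 → ¬ s ⊆ T)
    (hedge : ∀ e : Finset V, e.card = 2 → ∀ s, s ∈ P ∨ s ∈ Set.range t → e ⊆ s →
      (∃ s' ∈ P, s' ≠ s ∧ e ⊆ s') ∨ ∃ i, t i ≠ s ∧ e ⊆ t i) : False := by
  have hchain := fun i => hg.exists_chain (hne i)
    (fun T hT v hv => hdown T (hRF i T hT) _ (Finset.erase_subset _ _) (by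
      rw [← Finset.card_pos]
      have := Finset.card_erase_add_one hv
      have := hcard i T hT
      omega)) (hRF i) (hcard i)
    (fun T hT => hmatch4 T (hRF i T hT) (hcard i T hT)) (hint i) (hclosed i)
  choose c hc hbd using hchain
  have hsub : ∀ i, ∀ s ∈ boundaryFaces (R i), ∃ T ∈ R i, s ⊆ T := by
    intro i s hs
    obtain ⟨T, hT, v, _, rfl⟩ := mem_boundaryFaces.1 hs
    exact ⟨T, hT, Finset.erase_subset _ _⟩
  have hodd : ∀ i, ∀ e : Finset V, e.card = 2 → e ⊆ t i → ∃ u, c i u ≠ 0 ∧ e ⊆ u := by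
    intro i e he hei
    have h := hbd i e he
    rw [if_pos hei] at h
    obtain ⟨u, hu, hcu⟩ := Finset.exists_ne_zero_of_sum_ne_zero (h.trans_ne one_ne_zero)
    exact ⟨u, hcu, (Finset.mem_filter.1 hu).2⟩
  -- No triangle in `S` is matched upwards: those in `P` lie in no tetrahedron, and those in the
  -- chains have this property by construction.
  set S : Set (Finset V) := {s | s ∈ P ∨ ∃ i, c i s ≠ 0} with hS
  have hSF : ∀ s ∈ S, s ∈ F ∧ s.card = 3 ∧ ∀ T ∈ F, T.card = 4 → s ⊆ T → g s < g T := by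
    rintro s (hs | ⟨i, hs⟩)
    · exact ⟨(hPF s hs).1, (hPF s hs).2, fun T hT hT4 h => absurd h (hP s hs T hT hT4)⟩
    · obtain ⟨-, h1, h2⟩ := hc i s hs
      obtain ⟨T, hT, v, hv, rfl⟩ := mem_boundaryFaces.1 h1
      have h3 : (T.erase v).card = 3 := by
        have := Finset.card_erase_add_one hv
        have := hcard i T hT
        omega
      exact ⟨hdown T (hRF i T hT) _ (Finset.erase_subset _ _) (by rw [← Finset.card_pos]; omega),
        h3, h2⟩
  have hnext : ∀ s ∈ S, ∀ e ⊆ s, e.card = 2 → ∃ s' ∈ S, s' ≠ s ∧ e ⊆ s' := by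
    rintro s (hs | ⟨i, hs⟩) e hes he
    · rcases hedge e he s (Or.inl hs) hes with ⟨s', h1, h2, h3⟩ | ⟨i, -, h3⟩
      · exact ⟨s', Or.inl h1, h2, h3⟩
      · obtain ⟨u, hu, heu⟩ := hodd i e he h3
        refine ⟨u, Or.inr ⟨i, hu⟩, ?_, heu⟩
        rintro rfl
        obtain ⟨T, hT, h⟩ := hsub i u (hc i u hu).2.1
        exact hP u hs T (hRF i T hT) (hcard i T hT) h
    · obtain ⟨hst, hsR, -⟩ := hc i s hs
      obtain ⟨T, hT, hsT⟩ := hsub i s hsR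
      by_cases hei : e ⊆ t i
      · rcases hedge e he (t i) (Or.inr ⟨i, rfl⟩) hei with ⟨s', h1, -, h3⟩ | ⟨j, h2, h3⟩
        · refine ⟨s', Or.inl h1, ?_, h3⟩
          rintro rfl
          exact hP s' h1 T (hRF i T hT) (hcard i T hT) hsT
        · obtain ⟨u, hu, heu⟩ := hodd j e he h3
          refine ⟨u, Or.inr ⟨j, hu⟩, ?_, heu⟩
          rintro rfl
          -- A triangle common to two chains differs from `t i`, so by `hclosed` region `i` would
          -- contain a tetrahedron of region `j`.
          have hij : i ≠ j := by
            rintro rfl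
            exact h2 rfl
          obtain ⟨T', hT', huT'⟩ := hsub j u (hc j u hu).2.1
          obtain ⟨T'', hT'', v, hv, rfl⟩ := mem_boundaryFaces.1 hsR
          exact hdisj i j hij T'
            (hclosed i T'' hT'' v hv hst T' (hRF j T' hT') (hcard j T' hT') huT') hT'
      -- An edge outside `t i` meets an even number of triangles of the chain, so `s` is not the
      -- only one.
      · by_contra! hno
        have h := hbd i e he
        rw [if_neg hei, Finset.sum_eq_single s] at h
        · exact hs h
        · intro u hu hus
          by_contra hcu
          exact hno u (Or.inr ⟨i, hcu⟩) hus (Finset.mem_filter.1 hu).2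
        · intro hns
          exact absurd (Finset.mem_filter.2 ⟨hsR, hes⟩) hns
  -- The triangle of largest value in `S` is matched with one of its edges, and another member of
  -- `S` at that edge must have a larger value.
  obtain ⟨s, hsS, hmax⟩ := Set.exists_max_image S g (hFfin.subset fun s hs => (hSF s hs).1)
    (hPne.mono fun s hs => Or.inl hs)
  obtain ⟨hsF, hs3, hsup⟩ := hSF s hsS
  obtain ⟨v, hv, hle⟩ := hmatch3 s hsF hs3 hsup
  have he2 : (s.erase v).card = 2 := by
    have := Finset.card_erase_add_one hv
    omega
  obtain ⟨s', hs', hne', hes'⟩ := hnext s hsS (s.erase v) (Finset.erase_subset _ _) he2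
  have heF : s.erase v ∈ F :=
    hdown s hsF _ (Finset.erase_subset _ _) (by rw [← Finset.card_pos]; omega)
  have := hg.lt_of_le_up _ heF _ hsF _ (hSF s' hs').1 (Finset.erase_subset _ _)
    (by omega) hes' (by have := (hSF s' hs').2.1; omega) hne' hle
  linarith [hmax s' hs']

end Chains

/-! ### Passage from functions on faces to functions on all finite sets. -/

/-- A discrete Morse function, extended by zero to all finite sets. -/
noncomputable def extendByZero {V : Type*} {K : PreAbstractSimplicialComplex V}
    (f : K.faces → ℝ) (σ : Finset V) : ℝ :=
  open Classical in if h : σ ∈ K.faces then f ⟨σ, h⟩ else 0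

theorem extendByZero_of_mem {V : Type*} {K : PreAbstractSimplicialComplex V}
    (f : K.faces → ℝ) {σ : Finset V} (h : σ ∈ K.faces) : extendByZero f σ = f ⟨σ, h⟩ := dif_pos h

theorem isCodimOne_iff {V : Type*} {K : PreAbstractSimplicialComplex V} {σ τ : K.faces} :
    IsCodimOne σ τ ↔ σ.1 ⊆ τ.1 ∧ τ.1.card = σ.1.card + 1 := by
  refine ⟨fun h => ⟨h.1.subset, h.2⟩, fun h => ⟨h.1.ssubset_of_ne fun he => ?_, h.2⟩⟩
  have := h.2
  rw [he] at this
  omega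

/-- The value zero outside the complex is harmless, since `IsMorseOn` compares only values at faces.
-/
theorem IsDiscreteMorseFunction.isMorseOn {V : Type*} {K : PreAbstractSimplicialComplex V}
    {f : K.faces → ℝ} (hf : IsDiscreteMorseFunction f) :
    IsMorseOn K.faces (extendByZero f) where
  lt_of_le_up := by
    intro σ hσ τ hτ τ' hτ' h1 h2 h3 h4 hne hle
    rw [extendByZero_of_mem f hσ] at hle ⊢
    rw [extendByZero_of_mem f hτ] at hle
    rw [extendByZero_of_mem f hτ']
    exact hf.lt_of_matched_up ⟨isCodimOne_iff.2 ⟨h1, h2⟩, hle⟩ (isCodimOne_iff.2 ⟨h3, h4⟩)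
      fun h => hne (congrArg Subtype.val h)
  lt_of_le_down := by
    intro ρ hρ ρ' hρ' σ hσ h1 h2 h3 h4 hne hle
    rw [extendByZero_of_mem f hσ] at hle ⊢
    rw [extendByZero_of_mem f hρ] at hle
    rw [extendByZero_of_mem f hρ']
    exact hf.lt_of_matched_down ⟨isCodimOne_iff.2 ⟨h1, h2⟩, hle⟩ (isCodimOne_iff.2 ⟨h3, h4⟩)
      fun h => hne (congrArg Subtype.val h)

theorem exists_le_extendByZero_erase {V : Type*} [DecidableEq V]
    {K : PreAbstractSimplicialComplex V} {f : K.faces → ℝ} {σ : K.faces}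
    (h : ¬ IsFormanCritical f σ) (hup : ∀ τ, ¬ IsMatched f σ τ) :
    ∃ v ∈ σ.1, extendByZero f σ.1 ≤ extendByZero f (σ.1.erase v) := by
  rw [isFormanCritical_iff] at h
  push Not at h
  obtain ⟨ρ, hc, hle⟩ := h hup
  have h1 : (σ.1 \ ρ.1).card = 1 := by
    rw [Finset.card_sdiff_of_subset hc.1.subset, hc.2]; omega
  obtain ⟨v, hv⟩ := Finset.card_eq_one.1 h1
  have hv' : v ∈ σ.1 ∧ v ∉ ρ.1 := by
    rw [← Finset.mem_sdiff, hv]; simp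
  have he : ρ.1 = σ.1.erase v := by
    refine Finset.eq_of_subset_of_card_le (Finset.subset_erase.2 ⟨hc.1.subset, hv'.2⟩) ?_
    have := Finset.card_erase_add_one hv'.1
    have := hc.2
    omega
  refine ⟨v, hv'.1, ?_⟩
  rw [← he, extendByZero_of_mem f σ.2, extendByZero_of_mem f ρ.2]
  exact hle

/-! ### Bit masks of finite sets of vertices -/

/-- The bit mask of a finite set of natural numbers. -/
def faceMask (σ : Finset ℕ) : ℕ := ∑ v ∈ σ, 2 ^ v

theorem testBit_faceMask (σ : Finset ℕ) (i : ℕ) : (faceMask σ).testBit i ↔ i ∈ σ := by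
  rw [faceMask, ← Nat.mem_bitIndices, ← List.mem_toFinset, Finset.toFinset_bitIndices_sum_two_pow]

theorem faceMask_injective : Function.Injective faceMask := fun σ τ h => by
  ext i
  rw [← testBit_faceMask, h, testBit_faceMask]

theorem faceMask_land_eq_iff {σ τ : Finset ℕ} :
    Nat.land (faceMask σ) (faceMask τ) = faceMask σ ↔ σ ⊆ τ := by
  change faceMask σ &&& faceMask τ = faceMask σ ↔ σ ⊆ τ
  constructor
  · intro h i hi
    rw [← testBit_faceMask] at hi ⊢
    rw [← h, Nat.testBit_land, Bool.and_eq_true] at hi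
    exact hi.2
  · intro h
    refine Nat.eq_of_testBit_eq fun i => ?_
    rw [Nat.testBit_land, Bool.eq_iff_iff, Bool.and_eq_true, testBit_faceMask, testBit_faceMask]
    exact and_iff_left_of_imp fun hi => h hi

/-- The pair of faces that an entry `(v, σ)` of a list of removals stands for. -/
def removalPair (p : ℕ × Finset ℕ) : Finset ℕ × Finset ℕ := (p.2, insert p.1 p.2)

/-- The bit masks of the pair of faces that an entry `(v, σ)` of a list of removals stands for. -/
def removalMasks (p : ℕ × Finset ℕ) : ℕ × ℕ := (faceMask p.2, faceMask (insert p.1 p.2))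

/-- Inclusion of faces in terms of their bit masks. -/
def maskSubset (s t : ℕ) : Bool := (Nat.land s t).beq s

theorem maskSubset_faceMask {σ τ : Finset ℕ} :
    maskSubset (faceMask σ) (faceMask τ) = true ↔ σ ⊆ τ := by
  rw [maskSubset, Nat.beq_eq, faceMask_land_eq_iff]

/-- The computable form of `IsRemovalOrder`, in terms of bit masks. -/
def isRemovalOrderMask : List (ℕ × ℕ) → Bool
  | [] => true
  | p :: L => L.all (fun q => !maskSubset p.1 q.2) && isRemovalOrderMask L

theorem isRemovalOrder_of_mask {L : List (ℕ × Finset ℕ)}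
    (h : isRemovalOrderMask (L.map removalMasks) = true) :
    IsRemovalOrder (L.map removalPair) := by
  induction L with
  | nil => exact List.Pairwise.nil
  | cons p L ih =>
    rw [List.map_cons, isRemovalOrderMask, Bool.and_eq_true] at h
    refine List.Pairwise.cons (fun q hq hsub => ?_) (ih h.2)
    obtain ⟨q, hq', rfl⟩ := List.mem_map.1 hq
    have h1 := List.all_eq_true.1 h.1 _ (List.mem_map_of_mem hq')
    have h2 : maskSubset (removalMasks p).1 (removalMasks q).2 = true :=
      maskSubset_faceMask.2 hsub
    rw [h2] at h1
    exact absurd h1 (by decide)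

/-- The bit mask of the union of all faces in a list of removals. -/
def supportMask (L : List (ℕ × Finset ℕ)) : ℕ :=
  L.foldr (fun p m => Nat.lor (removalMasks p).2 m) 0

theorem testBit_supportMask {L : List (ℕ × Finset ℕ)} {p : ℕ × Finset ℕ} (hp : p ∈ L) {i : ℕ}
    (hi : i ∈ insert p.1 p.2) : (supportMask L).testBit i = true := by
  induction L with
  | nil => simp at hp
  | cons q L ih =>
    change ((removalMasks q).2 ||| supportMask L).testBit i = true
    rw [Nat.testBit_or, Bool.or_eq_true]
    rcases List.mem_cons.1 hp with rfl | hp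
    · exact Or.inl ((testBit_faceMask _ _).2 hi)
    · exact Or.inr (ih hp)

theorem maskSubset_supportMask {L : List (ℕ × Finset ℕ)} {p : ℕ × Finset ℕ} (hp : p ∈ L)
    {σ : Finset ℕ} (hσ : σ ⊆ insert p.1 p.2) :
    maskSubset (faceMask σ) (supportMask L) = true := by
  rw [maskSubset, Nat.beq_eq]
  change faceMask σ &&& supportMask L = faceMask σ
  refine Nat.eq_of_testBit_eq fun i => ?_
  rw [Nat.testBit_land, Bool.eq_iff_iff, Bool.and_eq_true, testBit_faceMask]
  exact and_iff_left_of_imp fun hi => testBit_supportMask hp (hσ hi)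

/-- No face in the list `B` contains the first face of an entry of `A`. -/
def isRemovedBefore (A B : List (ℕ × Finset ℕ)) : Bool :=
  -- The first disjunct is a shortcut: a face that is not contained in the union of all faces of `B`
  -- is contained in none of them, so no comparison one by one is needed.
  A.all fun p => !maskSubset (faceMask p.2) (supportMask B) ||
    B.all fun q => !maskSubset (removalMasks p).1 (removalMasks q).2

theorem not_subset_of_isRemovedBefore {A B : List (ℕ × Finset ℕ)}
    (h : isRemovedBefore A B = true) : ∀ p ∈ A, ∀ q ∈ B, ¬ p.2 ⊆ insert q.1 q.2 := by
  intro p hp q hq hsub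
  have h1 := List.all_eq_true.1 h p hp
  rw [maskSubset_supportMask hq hsub, Bool.not_true, Bool.false_or] at h1
  have h2 := List.all_eq_true.1 h1 q hq
  have h3 : maskSubset (removalMasks p).1 (removalMasks q).2 = true := maskSubset_faceMask.2 hsub
  rw [h3] at h2
  exact absurd h2 (by decide)

/-- A list of blocks of removals is a removal order if every block is one and different blocks
are in the right order. -/
theorem isRemovalOrder_flatten {B : List (List (ℕ × Finset ℕ))}
    (h1 : ∀ L ∈ B, isRemovalOrderMask (L.map removalMasks) = true)
    (h2 : B.Pairwise fun L L' => isRemovedBefore L L' = true) :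
    IsRemovalOrder (B.flatten.map removalPair) := by
  rw [IsRemovalOrder, List.pairwise_map, List.pairwise_flatten]
  refine ⟨fun L hL => ?_, h2.imp fun h => not_subset_of_isRemovedBefore h⟩
  have := isRemovalOrder_of_mask (h1 L hL)
  rwa [IsRemovalOrder, List.pairwise_map] at this

/-- In a complete list of removals, every face contained in a removed face is removed. This is
expressed for faces of codimension one. -/
def isCompleteMask : List (ℕ × Finset ℕ) → Bool
  | [] => true
  | p :: L =>
    -- Erasing `p.1 ∉ p.2` would give `p.2`, which is removed with the pair itself, so only vertices
    -- of `p.2` are erased. Mask `0` is the empty set, which is not a face.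
    decide (∀ w ∈ p.2, (faceMask ((insert p.1 p.2).erase w)).beq 0 ||
      L.any (fun q => maskSubset (faceMask ((insert p.1 p.2).erase w)) (removalMasks q).2)) &&
    isCompleteMask L

/-- A subset of the larger face of the first pair either omits a vertex of `p.2`, and is then
contained in a face of a later pair, or contains `p.2` and so is one of the two faces of the pair.
-/
theorem exists_eq_of_isCompleteMask {L : List (ℕ × Finset ℕ)} (h : isCompleteMask L = true)
    {σ : Finset ℕ} (hne : σ.Nonempty) (hσ : ∃ p ∈ L, σ ⊆ insert p.1 p.2) :
    ∃ p ∈ L, σ = p.2 ∨ σ = insert p.1 p.2 := by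
  induction L with
  | nil => simp at hσ
  | cons p L ih =>
    rw [isCompleteMask, Bool.and_eq_true, decide_eq_true_iff] at h
    suffices hs : (σ = p.2 ∨ σ = insert p.1 p.2) ∨ ∃ q ∈ L, σ ⊆ insert q.1 q.2 by
      rcases hs with hs | hs
      · exact ⟨p, List.mem_cons_self, hs⟩
      · obtain ⟨q, hq, h'⟩ := ih h.2 hs
        exact ⟨q, List.mem_cons_of_mem _ hq, h'⟩
    obtain ⟨q, hq, hsub⟩ := hσ
    rcases List.mem_cons.1 hq with rfl | hq
    · by_cases hw : ∃ w ∈ q.2, w ∉ σ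
      · right
        obtain ⟨w, hw, hwσ⟩ := hw
        have hsub' : σ ⊆ (insert q.1 q.2).erase w := Finset.subset_erase.2 ⟨hsub, hwσ⟩
        have h1 := h.1 w hw
        rw [Bool.or_eq_true, Nat.beq_eq] at h1
        rcases h1 with h1 | h1
        · have h2 : (insert q.1 q.2).erase w = ∅ := faceMask_injective (h1.trans (by simp [faceMask]))
          rw [h2, Finset.subset_empty] at hsub'
          exact absurd hsub' hne.ne_empty
        · obtain ⟨r, hr, h2⟩ := List.any_eq_true.1 h1
          exact ⟨r, hr, hsub'.trans (maskSubset_faceMask.1 h2)⟩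
      · left
        push Not at hw
        by_cases hv : q.1 ∈ σ
        · exact Or.inr (hsub.antisymm (Finset.insert_subset hv hw))
        · refine Or.inl (subset_antisymm (fun x hx => ?_) hw)
          rcases Finset.mem_insert.1 (hsub hx) with rfl | h
          · exact absurd hx hv
          · exact h
    · exact Or.inr ⟨q, hq, hsub⟩

/-! ### The removal order -/

/-- The removal of the part of `Σ₃'` with the vertices `14, …, 21` after that of the tetrahedron
`{1, 2, 3, 21}`: an entry `(v, σ)` stands for the pair of `σ` and `σ ∪ {v}`. -/
def coreRemovals : List (ℕ × Finset ℕ) :=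
  [(14, {1, 2, 21}), (16, {2, 3, 21}), (15, {2, 14, 21}), (19, {14, 15, 21}), (16, {2, 15, 21}),
   (18, {1, 3, 21}), (19, {1, 18, 21}), (3, {2, 14, 15}), (17, {18, 19, 21}), (17, {3, 16, 21}),
   (3, {17, 18, 21}), (19, {1, 14, 21}), (2, {3, 17, 18}), (2, {17, 18, 19}), (1, {2, 15, 16}),
   (15, {16, 17, 21}), (2, {1, 18, 19}), (17, {1, 15, 16}), (3, {14, 15, 19}), (20, {3, 15, 19}),
   (2, {3, 19, 20}), (17, {15, 19, 20}), (3, {1, 14, 19}), (21, {15, 17, 19}), (20, {2, 17, 19}),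
   (1, {2, 17, 20}), (1, {3, 15, 20}), (20, {1, 15, 17}), (3, {1, 16, 17})]

/-- The removal of the part of `Σ₃'` around the vertices `x` and `x + 7`. -/
def tubeRemovals (x : ℕ) : List (ℕ × Finset ℕ) :=
  [(4, {1, 2, x + 7}), (x, {1, 4, x + 7}), (3, {1, x, x + 7}), (4, {3, x, x + 7}),
   (6, {1, 4, x}), (6, {3, 4, x}), (5, {3, 6, x}), (4, {2, 3, x + 7}), (2, {5, 6, x}),
   (1, {3, 5, x}), (1, {2, 6, x}), (1, {2, 5, x}), (1, {3, x}), (1, {5, x}), (1, {2, x}),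
   (6, {1, x}), (4, {x, x + 7}), (6, {4, x}), (6, {x})]

/-- The removal of the remaining triangles, edges and vertices of `Σ₃'`. -/
def membraneRemovals : List (ℕ × Finset ℕ) :=
  [(19, {14, 21}), (3, {1, 16}), (4, {2, 15}), (3, {14, 15}), (3, {1, 14}), (21, {15, 19}),
   (3, {4, 15}), (3, {18, 21}), (1, {3, 15}), (20, {1, 15}), (17, {3, 21}), (16, {2, 21}),
   (2, {17, 18}), (3, {1, 18}), (4, {2, 16}), (4, {2, 17}), (17, {15, 20}), (4, {3, 18}),
   (3, {14, 19}), (4, {3, 14}), (2, {18, 19}), (15, {16, 21}), (17, {15, 16}), (19, {1, 21}),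
   (21, {15, 17}), (2, {4, 14}), (19, {17, 21}), (3, {16, 17}), (4, {3, 16}), (4, {2, 18}),
   (3, {4, 17}), (20, {17, 19}), (2, {19, 20}), (3, {1, 19}), (1, {3, 17}), (20, {1, 17}),
   (4, {2, 19}), (4, {2, 20}), (4, {3, 19}), (3, {4, 20}), (3, {1, 20}), (4, {18}), (4, {16}),
   (21, {15}), (2, {14}), (19, {21}), (20, {17}), (3, {20}), (4, {19})]

/-- The removal of all faces of a copy of `Σ₃`, except for those that subdivide its free triangle
`{t₁, t₂, t₃}` by the vertex `a`. -/
def sigmaThreeCopyRemovals (t₁ t₂ t₃ a : ℕ) : List (ℕ × Finset ℕ) :=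
  [(a + 8, {t₁, t₂, t₃}), (a + 5, {t₁, t₃, a + 8}), (a, {t₁, t₃, a + 5}), (t₂, {t₃, a, a + 5}),
   (a + 4, {t₂, t₃, a + 5}), (a + 8, {t₃, a + 4, a + 5}), (t₂, {t₁, a, a + 5}),
   (a + 6, {t₁, t₂, a + 5}), (a, {t₁, t₂, a + 6}), (a + 8, {t₁, a + 5, a + 6}),
   (a + 4, {a + 5, a + 6, a + 8}), (a + 2, {a + 4, a + 6, a + 8}), (a + 3, {t₂, t₃, a + 8}),
   (a, {t₂, t₃, a + 4}), (a + 1, {t₁, a + 6, a + 8}), (a + 7, {a + 2, a + 4, a + 6}),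
   (a + 1, {a + 2, a + 6, a + 8}), (t₂, {a + 4, a + 6, a + 7}), (t₂, {a + 1, a + 2, a + 8}),
   (a + 2, {t₂, a + 3, a + 8}), (t₃, {t₂, a + 6, a + 7}), (t₁, {t₃, a, a + 4}),
   (t₃, {t₂, a + 1, a + 2}), (a + 4, {a + 2, a + 3, a + 8}), (t₃, {t₂, a, a + 6}),
   (a + 6, {t₃, a + 1, a + 2}), (a, {t₂, t₃, a + 7}), (a + 4, {t₃, a + 3, a + 8}),
   (a, {t₂, t₃, a + 3}), (t₃, {t₁, a, a + 6}), (t₂, {t₁, a, a + 4}), (a + 1, {t₁, t₃, a + 6}),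
   (t₁, {a + 2, a + 3, a + 4}), (t₂, {t₁, a + 1, a + 8}), (a + 7, {t₃, a + 2, a + 6}),
   (a, {t₁, t₃, a + 1}), (t₂, {t₁, a, a + 1}), (t₂, {a + 4, a + 5, a + 6}),
   (t₁, {t₂, a + 2, a + 3}), (t₃, {t₂, a, a + 1}), (t₁, {t₂, a, a + 7}), (t₃, {t₁, a, a + 7}),
   (t₁, {t₂, a + 4, a + 7}), (t₁, {t₃, a + 3, a + 4}), (t₁, {t₂, a, a + 3}),
   (t₁, {t₃, a, a + 3}), (a + 2, {t₁, a + 4, a + 7}), (a, {t₂, t₃, a + 2}), (t₁, {t₂, a, a + 2}),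
   (t₁, {t₃, a, a + 2}), (t₁, {t₃, a + 2, a + 7}), (t₁, {t₂, a + 3}), (t₁, {a, a + 2}),
   (a + 4, {a + 3, a + 8}), (t₂, {a, a + 4}), (t₃, {a, a + 6}), (t₂, {a + 5, a + 6}),
   (a + 8, {t₁, a + 5}), (a + 6, {a + 1, a + 2}), (a + 8, {t₃, a + 5}), (t₁, {a + 3, a + 4}),
   (a + 1, {t₁, a + 6}), (a + 4, {a + 5, a + 8}), (t₂, {a + 4, a + 5}), (t₁, {a + 2, a + 3}),
   (t₂, {a, a + 5}), (t₁, {t₃, a + 2}), (t₂, {a + 4, a + 6}), (t₁, {t₂, a + 7}),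
   (t₃, {a, a + 7}), (a + 7, {a + 2, a + 6}), (a + 2, {a + 4, a + 7}), (t₁, {a, a + 3}),
   (a + 1, {a + 6, a + 8}), (t₂, {a + 1, a + 8}), (t₃, {t₁, a + 3}), (t₃, {a + 6, a + 7}),
   (t₃, {a, a + 1}), (t₁, {t₂, a + 4}), (t₁, {t₃, a + 7}), (a + 4, {t₃, a + 8}),
   (t₃, {a + 1, a + 6}), (t₁, {a + 2, a + 7}), (t₂, {t₃, a + 6}), (t₂, {t₁, a + 1}),
   (t₃, {t₂, a + 1}), (t₁, {t₃, a + 4}), (a + 2, {a + 4, a + 8}), (t₂, {t₁, a + 8}),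
   (a + 2, {t₁, a + 4}), (t₂, {t₁, a + 2}), (t₂, {a + 2, a + 8}), (t₂, {a + 8}), (t₃, {a + 1}),
   (t₃, {a + 3}), (t₂, {a + 6}), (t₂, {a + 5}), (t₁, {a + 7}), (a + 2, {a + 4}), (t₂, {a + 2})]

/-- The removal of the faces subdividing the triangle `{t₁, t₂, t₃}` by the vertex `a`, by means
of the edge `{t₁, t₂}`. -/
def subdivisionRemovals (t₁ t₂ t₃ a : ℕ) : List (ℕ × Finset ℕ) :=
  [(a, {t₁, t₂}), (t₃, {t₁, a}), (t₃, {t₂, a}), (t₃, {a})]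

/-- The removal of `Σ₂`, once the edge `{1, 2}` is free, and of the remaining graph. -/
def sigmaTwoRemovals : List (ℕ × Finset ℕ) :=
  [(3, {1, 2}), (23, {1, 3}), (22, {1, 23}), (25, {3, 23}), (24, {23, 25}), (2, {23, 24}),
   (2, {22, 23}), (25, {2, 3}), (22, {2, 25}), (1, {22, 25}), (24, {1, 22}), (24, {2, 22}),
   (25, {1, 24}), (6, {4}), (2, {23}), (2, {6}), (24, {22}), (1, {5}), (25, {1}), (25, {3}),
   (24, {2}), (24, {25})]

/-- The triangles `{t₁, t₂, t₃}` to which copies of `Σ₃` are glued, with the first new vertex `a`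
of the copy. -/
def gluingData : List (ℕ × ℕ × ℕ × ℕ) :=
  [(1, 2, 5, 26), (1, 2, 6, 35), (1, 2, 4, 44), (1, 3, 5, 53), (1, 4, 6, 62), (2, 3, 4, 71),
   (2, 5, 6, 80), (3, 4, 6, 89), (3, 5, 6, 98)]

/-- The removal of `Σ₃'`, except for the triangles to which copies of `Σ₃` are glued and the
triangle `{1, 2, 3}`. -/
def sigmaThreeModRemovals : List (ℕ × Finset ℕ) :=
  -- Since `1 ∈ {1, 2, 3, 21}`, this entry removes the tetrahedron alone. The triangle `{1, 2, 3}`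
  -- is thus kept for its pairing with the edge `{1, 2}` in `sigmaTwoRemovals`.
  (1, {1, 2, 3, 21}) :: coreRemovals ++ [7, 8, 9, 10, 11, 12, 13].flatMap tubeRemovals ++
    membraneRemovals

/-- The removal of the 2-dimensional complex that remains after that of the tetrahedra. -/
def lastRemovals : List (ℕ × Finset ℕ) :=
  -- The triangle `{1, 2, 44}` is removed alone, and the rest of the subdivided triangle `{1, 2, 4}`
  -- collapses through this hole.
  [(1, {1, 2, 44}), (4, {1, 44}), (4, {2, 44}), (4, {44})] ++
  -- Each triple is reordered so that its first two vertices span an edge freed by the preceding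
  -- removals.
  [(2, 4, 3, 71), (1, 4, 6, 62), (1, 6, 2, 35), (3, 4, 6, 89), (3, 6, 5, 98), (3, 5, 1, 53),
    (5, 6, 2, 80), (2, 5, 1, 26)].flatMap
    (fun q => subdivisionRemovals q.1 q.2.1 q.2.2.1 q.2.2.2) ++
  sigmaTwoRemovals ++ [(24, {24})]

/-- A removal order of all faces of `two_optima` with three faces removed on their own, as a list
of blocks. -/
def twoOptimaBlocks : List (List (ℕ × Finset ℕ)) :=
  sigmaThreeModRemovals ::
    (gluingData.map fun q => sigmaThreeCopyRemovals q.1 q.2.1 q.2.2.1 q.2.2.2) ++ [lastRemovals]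

theorem isRemovalOrder_twoOptimaBlocks :
    IsRemovalOrder (twoOptimaBlocks.flatten.map removalPair) :=
  isRemovalOrder_flatten (by decide +kernel) (by decide +kernel)

theorem isCompleteMask_twoOptimaBlocks : isCompleteMask twoOptimaBlocks.flatten = true := by
  decide +kernel

/-- The facets of `two_optima`, with one block for every copy of `Σ₃`. -/
theorem twoOptimaFacets_eq : twoOptimaFacets = sigmaTwoFacets ++ (sigmaThreeModFacets ++
    gluingData.flatMap fun q => sigmaThreeCopyFacets q.1 q.2.1 q.2.2.1 q.2.2.2) := by
  simp only [twoOptimaFacets, gluingData, List.flatMap_cons, List.flatMap_nil, List.append_assoc,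
    List.append_nil]

theorem mem_twoOptimaFacets {F : Finset ℕ} : F ∈ twoOptimaFacets ↔ F ∈ sigmaTwoFacets ∨
    F ∈ sigmaThreeModFacets ∨
    ∃ q ∈ gluingData, F ∈ sigmaThreeCopyFacets q.1 q.2.1 q.2.2.1 q.2.2.2 := by
  rw [twoOptimaFacets_eq, List.mem_append, List.mem_append, List.mem_flatMap]

theorem mem_twoOptimaBlocks {p : ℕ × Finset ℕ} : p ∈ twoOptimaBlocks.flatten ↔
    p ∈ sigmaThreeModRemovals ∨
    (∃ q ∈ gluingData, p ∈ sigmaThreeCopyRemovals q.1 q.2.1 q.2.2.1 q.2.2.2) ∨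
    p ∈ lastRemovals := by
  rw [twoOptimaBlocks, List.flatten_append, List.flatten_cons, List.append_assoc, List.mem_append,
    List.mem_append, ← List.flatMap_def, List.mem_flatMap, List.flatten_singleton]

/-- All faces in `A` are contained in faces in `B`. -/
def isRefinementMask (A B : List ℕ) : Bool := A.all fun s => B.any fun t => maskSubset s t

theorem exists_of_isRefinementMask {A B : List (Finset ℕ)}
    (h : isRefinementMask (A.map faceMask) (B.map faceMask) = true) :
    ∀ σ ∈ A, ∃ τ ∈ B, σ ⊆ τ := by
  intro σ hσ
  have h1 := List.all_eq_true.1 h _ (List.mem_map_of_mem hσ)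
  obtain ⟨t, ht, h2⟩ := List.any_eq_true.1 h1
  obtain ⟨τ, hτ, rfl⟩ := List.mem_map.1 ht
  exact ⟨τ, hτ, maskSubset_faceMask.1 h2⟩

theorem exists_removal_of_mem_facets : ∀ F ∈ twoOptimaFacets,
    ∃ p ∈ twoOptimaBlocks.flatten, F ⊆ insert p.1 p.2 := by
  have h1 : isRefinementMask (sigmaTwoFacets.map faceMask)
      ((lastRemovals.map fun p => insert p.1 p.2).map faceMask) = true := by decide +kernel
  have h2 : isRefinementMask (sigmaThreeModFacets.map faceMask)
      ((sigmaThreeModRemovals.map fun p => insert p.1 p.2).map faceMask) = true := by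
    decide +kernel
  have h3 : ∀ q ∈ gluingData, isRefinementMask
      ((sigmaThreeCopyFacets q.1 q.2.1 q.2.2.1 q.2.2.2).map faceMask)
      (((sigmaThreeCopyRemovals q.1 q.2.1 q.2.2.1 q.2.2.2).map
        fun p => insert p.1 p.2).map faceMask) = true := by
    decide +kernel
  intro F hF
  simp only [mem_twoOptimaBlocks]
  rcases mem_twoOptimaFacets.1 hF with hF | hF | ⟨q, hq, hF⟩
  · obtain ⟨τ, hτ, h⟩ := exists_of_isRefinementMask h1 F hF
    obtain ⟨p, hp, rfl⟩ := List.mem_map.1 hτ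
    exact ⟨p, Or.inr (Or.inr hp), h⟩
  · obtain ⟨τ, hτ, h⟩ := exists_of_isRefinementMask h2 F hF
    obtain ⟨p, hp, rfl⟩ := List.mem_map.1 hτ
    exact ⟨p, Or.inl hp, h⟩
  · obtain ⟨τ, hτ, h⟩ := exists_of_isRefinementMask (h3 q hq) F hF
    obtain ⟨p, hp, rfl⟩ := List.mem_map.1 hτ
    exact ⟨p, Or.inr (Or.inl ⟨q, hq, hp⟩), h⟩

theorem exists_facet_of_mem_removals : ∀ p ∈ twoOptimaBlocks.flatten,
    ∃ F ∈ twoOptimaFacets, insert p.1 p.2 ⊆ F := by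
  have h1 : isRefinementMask ((lastRemovals.map fun p => insert p.1 p.2).map faceMask)
      (twoOptimaFacets.map faceMask) = true := by decide +kernel
  have h2 : isRefinementMask
      ((sigmaThreeModRemovals.map fun p => insert p.1 p.2).map faceMask)
      (sigmaThreeModFacets.map faceMask) = true := by
    decide +kernel
  have h3 : ∀ q ∈ gluingData, isRefinementMask
      (((sigmaThreeCopyRemovals q.1 q.2.1 q.2.2.1 q.2.2.2).map
        fun p => insert p.1 p.2).map faceMask)
      ((sigmaThreeCopyFacets q.1 q.2.1 q.2.2.1 q.2.2.2).map faceMask) = true := by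
    decide +kernel
  intro p hp
  rcases mem_twoOptimaBlocks.1 hp with hp | ⟨q, hq, hp⟩ | hp
  · obtain ⟨F, hF, h⟩ := exists_of_isRefinementMask h2 _ (List.mem_map_of_mem hp)
    exact ⟨F, mem_twoOptimaFacets.2 (Or.inr (Or.inl hF)), h⟩
  · obtain ⟨F, hF, h⟩ := exists_of_isRefinementMask (h3 q hq) _ (List.mem_map_of_mem hp)
    exact ⟨F, mem_twoOptimaFacets.2 (Or.inr (Or.inr ⟨q, hq, hF⟩)), h⟩
  · exact exists_of_isRefinementMask h1 _ (List.mem_map_of_mem hp)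

theorem mem_twoOptima_iff {σ : Finset ℕ} :
    σ ∈ twoOptima.faces ↔
      ∃ p ∈ twoOptimaBlocks.flatten.map removalPair, σ = p.1 ∨ σ = p.2 := by
  have hmap : (∃ p ∈ twoOptimaBlocks.flatten.map removalPair, σ = p.1 ∨ σ = p.2) ↔
      ∃ p ∈ twoOptimaBlocks.flatten, σ = p.2 ∨ σ = insert p.1 p.2 := by
    simp only [List.mem_map, exists_exists_and_eq_and, removalPair]
  rw [hmap]
  constructor
  · rintro ⟨hne, F, hF, hσ⟩
    obtain ⟨p, hp, h⟩ := exists_removal_of_mem_facets F hF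
    exact exists_eq_of_isCompleteMask isCompleteMask_twoOptimaBlocks hne ⟨p, hp, hσ.trans h⟩
  · have hne : ∀ p ∈ twoOptimaBlocks.flatten, p.2 ≠ ∅ := by decide +kernel
    rintro ⟨p, hp, hσ⟩
    obtain ⟨F, hF, h⟩ := exists_facet_of_mem_removals p hp
    rcases hσ with rfl | rfl
    · exact ⟨Finset.nonempty_iff_ne_empty.2 (hne p hp), F, hF, (Finset.subset_insert _ _).trans h⟩
    · exact ⟨Finset.insert_nonempty _ _, F, hF, h⟩

/-- An entry `(v, σ)` with `v ∈ σ` stands for the single face `σ`, so these entries are the critical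
faces. -/
theorem filter_twoOptimaBlocks : twoOptimaBlocks.flatten.filter (fun p => p.1 ∈ p.2) =
    [(1, {1, 2, 3, 21}), (1, {1, 2, 44}), (24, {24})] := by
  decide +kernel

theorem exists_discreteMorse_twoOptima : ∃ f : twoOptima.faces → ℝ,
    IsDiscreteMorseFunction f ∧ ∀ σ : twoOptima.faces, IsFormanCritical f σ ↔
      σ.1 = {1, 2, 3, 21} ∨ σ.1 = {1, 2, 44} ∨ σ.1 = {24} := by
  obtain ⟨f, hf, hc⟩ := isRemovalOrder_twoOptimaBlocks.exists_isDiscreteMorseFunction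
    (K := twoOptima) (by
      intro p hp
      obtain ⟨q, -, rfl⟩ := List.mem_map.1 hp
      exact ⟨Finset.subset_insert _ _, Finset.card_insert_le _ _⟩) (fun σ => mem_twoOptima_iff)
  refine ⟨f, hf, fun σ => (hc σ).trans ?_⟩
  have h : ∀ v : ℕ, ∀ τ : Finset ℕ, ((v, τ) ∈ twoOptimaBlocks.flatten ∧ v ∈ τ) ↔
      (v, τ) = (1, {1, 2, 3, 21}) ∨ (v, τ) = (1, {1, 2, 44}) ∨ (v, τ) = (24, {24}) := by
    intro v τ
    have := List.mem_filter (p := fun p : ℕ × Finset ℕ => p.1 ∈ p.2) (x := (v, τ))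
      (as := twoOptimaBlocks.flatten)
    rw [filter_twoOptimaBlocks] at this
    simpa [Prod.ext_iff, eq_comm] using this.symm
  rw [List.mem_map]
  constructor
  · rintro ⟨⟨v, τ⟩, hp, he⟩
    obtain ⟨h1, h2⟩ := Prod.ext_iff.1 he
    simp only [removalPair] at h1 h2
    have hv : v ∈ τ := by
      rw [h1, ← h2]
      exact Finset.mem_insert_self _ _
    rcases (h v τ).1 ⟨hp, hv⟩ with h | h | h <;> rw [← h1, (Prod.mk.inj h).2] <;> simp
  · have hr : ∀ v : ℕ, ((v, σ.1) = (1, {1, 2, 3, 21}) ∨ (v, σ.1) = (1, {1, 2, 44}) ∨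
        (v, σ.1) = (24, {24})) → ∃ p ∈ twoOptimaBlocks.flatten, removalPair p = (σ.1, σ.1) := by
      intro v hv
      obtain ⟨h1, h2⟩ := (h v σ.1).2 hv
      exact ⟨(v, σ.1), h1, by rw [removalPair, Finset.insert_eq_of_mem h2]⟩
    rintro (h | h | h)
    · exact hr 1 (Or.inl (by rw [h]))
    · exact hr 1 (Or.inr (Or.inl (by rw [h])))
    · exact hr 24 (Or.inr (Or.inr (by rw [h])))

/-! ### The complex `two_optima` -/

theorem card_le_four_of_mem_facets : ∀ F ∈ twoOptimaFacets, F.card ≤ 4 := by decide +kernel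

theorem twoOptima_down {τ σ : Finset ℕ} (hτ : τ ∈ twoOptima.faces) (h : σ ⊆ τ)
    (hne : σ.Nonempty) : σ ∈ twoOptima.faces :=
  (twoOptima.isRelLowerSet_faces hτ).2 h hne

theorem card_le_four {σ : Finset ℕ} (hσ : σ ∈ twoOptima.faces) : σ.card ≤ 4 := by
  obtain ⟨-, F, hF, h⟩ := hσ
  exact (Finset.card_le_card h).trans (card_le_four_of_mem_facets F hF)

theorem mem_facets_of_card_eq_four {σ : Finset ℕ} (hσ : σ ∈ twoOptima.faces) (h4 : σ.card = 4) :
    σ ∈ twoOptimaFacets := by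
  obtain ⟨-, F, hF, h⟩ := hσ
  rwa [Finset.eq_of_subset_of_card_le h (h4 ▸ card_le_four_of_mem_facets F hF)]

theorem mem_twoOptima_of_mem_facets {F : Finset ℕ} (hF : F ∈ twoOptimaFacets)
    (hne : F.Nonempty) : F ∈ twoOptima.faces := ⟨hne, F, hF, subset_rfl⟩

theorem finite_complexOfFacets {V : Type*} (L : List (Finset V)) :
    (complexOfFacets L).faces.Finite := by
  refine Set.Finite.subset (L.finite_toSet.biUnion fun F _ => F.powerset.finite_toSet) ?_
  rintro σ ⟨-, F, hF, h⟩
  exact Set.mem_biUnion (x := F) hF (Finset.mem_coe.2 (Finset.mem_powerset.2 h))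

theorem finite_twoOptima : twoOptima.faces.Finite := finite_complexOfFacets _

instance : Finite twoOptima.faces := finite_twoOptima

theorem mem_twoOptima_one_two_three_twentyone : ({1, 2, 3, 21} : Finset ℕ) ∈ twoOptima.faces :=
  mem_twoOptima_of_mem_facets (by decide +kernel) (by simp)

instance : Nonempty twoOptima.faces := ⟨⟨_, mem_twoOptima_one_two_three_twentyone⟩⟩

theorem complexDim_twoOptima : complexDim twoOptima = 3 := by
  refine IsGreatest.csSup_eq ⟨⟨_, mem_twoOptima_one_two_three_twentyone, rfl⟩, ?_⟩
  rintro k ⟨σ, hσ, hk⟩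
  have := card_le_four hσ
  omega

theorem faceCountVector_twoOptima (P : twoOptima.faces → Prop) :
    faceCountVector twoOptima P = [{σ | P σ ∧ σ.1.card = 1}.ncard, {σ | P σ ∧ σ.1.card = 2}.ncard,
      {σ | P σ ∧ σ.1.card = 3}.ncard, {σ | P σ ∧ σ.1.card = 4}.ncard] := by
  rw [faceCountVector, complexDim_twoOptima]
  rfl

theorem ncard_faces_eq {K : PreAbstractSimplicialComplex ℕ} {P : K.faces → Prop}
    {A : Finset (Finset ℕ)} (hA : ∀ σ ∈ A, σ ∈ K.faces) (hP : ∀ σ, P σ ↔ σ.1 ∈ A) (k : ℕ) :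
    {σ | P σ ∧ σ.1.card = k}.ncard = (A.filter (·.card = k)).card := by
  rw [← Set.ncard_image_of_injective _ Subtype.val_injective, ← Set.ncard_coe_finset]
  congr 1
  ext σ
  simp only [Set.mem_image, Finset.coe_filter]
  constructor
  · rintro ⟨τ, ⟨h1, h2⟩, rfl⟩
    exact ⟨(hP τ).1 h1, h2⟩
  · rintro ⟨h1, h2⟩
    exact ⟨⟨σ, hA σ h1⟩, ⟨(hP _).2 h1, h2⟩, rfl⟩

theorem exists_discreteMorse_twoOptima_vector : ∃ f : twoOptima.faces → ℝ,
    IsDiscreteMorseFunction f ∧ faceCountVector twoOptima (IsFormanCritical f) = [1, 0, 1, 1] := by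
  obtain ⟨f, hf, hc⟩ := exists_discreteMorse_twoOptima
  refine ⟨f, hf, ?_⟩
  have hA : ∀ σ ∈ ({{1, 2, 3, 21}, {1, 2, 44}, {24}} : Finset (Finset ℕ)), σ ∈ twoOptima.faces := by
    have h : ∀ σ ∈ ({{1, 2, 3, 21}, {1, 2, 44}, {24}} : Finset (Finset ℕ)),
        σ ≠ ∅ ∧ ∃ F ∈ twoOptimaFacets, σ ⊆ F := by decide +kernel
    exact fun σ hσ => ⟨Finset.nonempty_iff_ne_empty.2 (h σ hσ).1, (h σ hσ).2⟩
  have hP : ∀ σ : twoOptima.faces, IsFormanCritical f σ ↔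
      σ.1 ∈ ({{1, 2, 3, 21}, {1, 2, 44}, {24}} : Finset (Finset ℕ)) := by
    intro σ
    simpa only [Finset.mem_insert, Finset.mem_singleton] using hc σ
  rw [faceCountVector_twoOptima]
  simp only [ncard_faces_eq hA hP]
  decide

/-! ### The tetrahedra collapse in every order -/

/-- This makes the tetrahedra collapsible in any order. The tetrahedron of `S` removed first is the
only one in `S` containing its partner; the one tetrahedron without a partner has the free triangle
`{1, 2, 3}` instead. -/
theorem exists_triangle_in_unique_tetrahedron {S : Set (Finset ℕ)} (hne : S.Nonempty)
    (hS : ∀ τ ∈ S, τ ∈ twoOptima.faces ∧ τ.card = 4) :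
    ∃ T ∈ S, ∃ t ⊂ T, t.card = 3 ∧ ∀ τ ∈ S, t ⊆ τ → τ = T := by
  have hsub : ∀ p ∈ twoOptimaBlocks.flatten.map removalPair, p.1 ⊆ p.2 := by
    intro p hp
    obtain ⟨q, -, rfl⟩ := List.mem_map.1 hp
    exact Finset.subset_insert _ _
  obtain ⟨p, hp, hpS, huniq⟩ := isRemovalOrder_twoOptimaBlocks.exists_maximal hsub hne (by
    intro τ hτ
    obtain ⟨p, hp, h⟩ := mem_twoOptima_iff.1 (hS τ hτ).1
    refine ⟨p, hp, ?_⟩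
    -- No face has more than four vertices, so a tetrahedron is always the larger member of its
    -- pair.
    rcases h with h | h
    · have hp2 : p.2 ∈ twoOptima.faces := mem_twoOptima_iff.2 ⟨p, hp, Or.inr rfl⟩
      refine (Finset.eq_of_subset_of_card_le (h ▸ hsub p hp) ?_).symm
      rw [(hS τ hτ).2]
      exact card_le_four hp2
    · exact h.symm)
  obtain ⟨⟨v, σ⟩, hq, rfl⟩ := List.mem_map.1 hp
  simp only [removalPair] at hpS huniq
  have h4 := (hS _ hpS).2
  by_cases hv : v ∈ σ
  · have hmem : (v, σ) ∈ twoOptimaBlocks.flatten.filter (fun p => p.1 ∈ p.2) :=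
      List.mem_filter.2 ⟨hq, by simpa using hv⟩
    rw [Finset.insert_eq_of_mem hv] at hpS h4
    have hσ : σ = {1, 2, 3, 21} := by
      rw [filter_twoOptimaBlocks] at hmem
      simp only [List.mem_cons, Prod.mk.injEq, List.not_mem_nil, or_false] at hmem
      rcases hmem with ⟨-, h⟩ | ⟨-, h⟩ | ⟨-, h⟩
      · exact h
      · rw [h] at h4
        exact absurd h4 (by decide)
      · rw [h] at h4
        exact absurd h4 (by decide)
    have hfree : ∀ F ∈ twoOptimaFacets, {1, 2, 3} ⊆ F → F = {1, 2, 3, 21} := by decide +kernel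
    refine ⟨σ, hpS, {1, 2, 3}, by rw [hσ]; decide, rfl, fun τ hτ h => ?_⟩
    rw [hσ]
    exact hfree τ (mem_facets_of_card_eq_four (hS τ hτ).1 (hS τ hτ).2) h
  · rw [Finset.card_insert_of_notMem hv] at h4
    exact ⟨_, hpS, σ, Finset.ssubset_insert hv, by omega, huniq⟩

/-- Some triangle lies in exactly one tetrahedron of the sublevel complex of `δ`. As no face has
dimension above three, this triangle is free there, contrary to `no_free_face`. -/
theorem not_isLevelCritical_of_card_eq_four {f : twoOptima.faces → ℤ}
    (hf : IsMonotoneDiscreteMorseFunction f) {δ : twoOptima.faces} (h4 : δ.1.card = 4) :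
    ¬ IsLevelCritical f δ := by
  intro hδ
  obtain ⟨T, ⟨⟨hT, hfT⟩, hT4⟩, t, htT, ht3, huniq⟩ := exists_triangle_in_unique_tetrahedron
    (S := {τ | τ ∈ sublevelFaces f (f δ) ∧ τ.card = 4}) ⟨δ.1, ⟨δ.2, le_rfl⟩, h4⟩
    (fun τ hτ => ⟨hτ.1.1, hτ.2⟩)
  have ht : t ∈ twoOptima.faces :=
    twoOptima_down hT htT.subset (by rw [← Finset.card_pos]; omega)
  refine hf.no_free_face δ hδ t (by omega) ⟨⟨ht, (hf.monotone ⟨t, ht⟩ ⟨T, hT⟩ htT.subset).trans hfT⟩,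
    T, ⟨⟨hT, hfT⟩, htT⟩, ?_⟩
  rintro τ ⟨⟨hτ, hfτ⟩, htτ⟩
  refine huniq τ ⟨⟨hτ, hfτ⟩, ?_⟩ htτ.subset
  have := Finset.card_lt_card htτ
  have := card_le_four hτ
  omega

theorem faceCountVector_ne_of_isMonotone {f : twoOptima.faces → ℤ}
    (hf : IsMonotoneDiscreteMorseFunction f) :
    faceCountVector twoOptima (IsLevelCritical f) ≠ [1, 0, 1, 1] := by
  intro h
  rw [faceCountVector_twoOptima] at h
  simp only [List.cons.injEq] at h
  have h0 : {σ : twoOptima.faces | IsLevelCritical f σ ∧ σ.1.card = 4} = ∅ :=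
    Set.eq_empty_of_forall_notMem fun σ hσ => not_isLevelCritical_of_card_eq_four hf hσ.2 hσ.1
  rw [h0, Set.ncard_empty] at h
  omega

/-! ### The complex is not collapsible -/

/-- The triangle to which a copy of `Σ₃` is glued. -/
def gluingTriangle (q : ℕ × ℕ × ℕ × ℕ) : Finset ℕ := {q.1, q.2.1, q.2.2.1}

/-- The tetrahedra of a copy of `Σ₃`. -/
def copyTetrahedra (q : ℕ × ℕ × ℕ × ℕ) : List (Finset ℕ) :=
  sigmaThreeCopyFacets q.1 q.2.1 q.2.2.1 q.2.2.2

theorem mem_twoOptimaFacets_of_mem_copy {q : ℕ × ℕ × ℕ × ℕ} (hq : q ∈ gluingData) {T : Finset ℕ}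
    (hT : T ∈ copyTetrahedra q) : T ∈ twoOptimaFacets :=
  mem_twoOptimaFacets.2 (Or.inr (Or.inr ⟨q, hq, hT⟩))

theorem card_copyTetrahedra : ∀ q ∈ gluingData, ∀ T ∈ copyTetrahedra q, T.card = 4 := by
  decide +kernel

theorem copyTetrahedra_interior : ∀ q ∈ gluingData, ∀ T ∈ copyTetrahedra q, ∀ v ∈ T,
    T.erase v = gluingTriangle q ∨ ∃ T' ∈ copyTetrahedra q, T' ≠ T ∧ T.erase v ⊆ T' := by
  have h : ∀ q ∈ gluingData, ∀ T ∈ copyTetrahedra q, ∀ v ∈ T, T.erase v = gluingTriangle q ∨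
      (copyTetrahedra q).any (fun T' => !(faceMask T').beq (faceMask T) &&
        maskSubset (faceMask (T.erase v)) (faceMask T')) = true := by
    decide +kernel
  intro q hq T hT v hv
  refine (h q hq T hT v hv).imp_right fun h => ?_
  obtain ⟨T', hT', h'⟩ := List.any_eq_true.1 h
  rw [Bool.and_eq_true, maskSubset_faceMask] at h'
  refine ⟨T', hT', ?_, h'.2⟩
  rintro rfl
  rw [Nat.beq_refl] at h'
  exact absurd h'.1 (by decide)

/-- The vertices of a copy of `Σ₃` outside its glueing triangle. -/
def IsCopyVertex (q : ℕ × ℕ × ℕ × ℕ) (w : ℕ) : Prop := q.2.2.2 ≤ w ∧ w < q.2.2.2 + 9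

instance (q : ℕ × ℕ × ℕ × ℕ) (w : ℕ) : Decidable (IsCopyVertex q w) :=
  inferInstanceAs (Decidable (_ ∧ _))

/-- The vertices `a, …, a + 8` belong to one copy only. A triangle of the copy other than the
glueing triangle has such a vertex, so all tetrahedra containing it are in that copy; this gives
`hclosed`. -/
theorem exists_isCopyVertex : ∀ q ∈ gluingData, ∀ T ∈ copyTetrahedra q, ∀ v ∈ T,
    T.erase v = gluingTriangle q ∨ ∃ w ∈ T.erase v, IsCopyVertex q w := by
  decide +kernel

theorem exists_isCopyVertex_tetrahedron : ∀ q ∈ gluingData, ∀ T ∈ copyTetrahedra q,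
    ∃ w ∈ T, IsCopyVertex q w := by
  decide +kernel

theorem copyTetrahedra_vertices : ∀ q ∈ gluingData, ∀ T ∈ copyTetrahedra q, ∀ w ∈ T,
    w < 26 ∨ IsCopyVertex q w := by
  decide +kernel

theorem IsCopyVertex.eq {w : ℕ} {q q' : ℕ × ℕ × ℕ × ℕ} (hq : q ∈ gluingData)
    (hq' : q' ∈ gluingData) (h : IsCopyVertex q w) (h' : IsCopyVertex q' w) : q = q' := by
  have hdisj : ∀ q ∈ gluingData, ∀ q' ∈ gluingData,
      q = q' ∨ q.2.2.2 + 9 ≤ q'.2.2.2 ∨ q'.2.2.2 + 9 ≤ q.2.2.2 := by decide +kernel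
  obtain ⟨h1, h2⟩ := h
  obtain ⟨h3, h4⟩ := h'
  rcases hdisj q hq q' hq' with h | h | h
  · exact h
  · omega
  · omega

theorem IsCopyVertex.le {w : ℕ} {q : ℕ × ℕ × ℕ × ℕ} (hq : q ∈ gluingData)
    (h : IsCopyVertex q w) : 26 ≤ w := by
  have h26 : ∀ q ∈ gluingData, 26 ≤ q.2.2.2 := by decide
  exact (h26 q hq).trans h.1

theorem mem_copy_of_isCopyVertex {q : ℕ × ℕ × ℕ × ℕ} (hq : q ∈ gluingData) {T : Finset ℕ}
    (hT : T ∈ twoOptimaFacets) {w : ℕ} (hw : w ∈ T) (hc : IsCopyVertex q w) :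
    T ∈ copyTetrahedra q := by
  have h1 : ∀ T ∈ sigmaTwoFacets, ∀ w ∈ T, w < 26 := by decide +kernel
  have h2 : ∀ T ∈ sigmaThreeModFacets, ∀ w ∈ T, w < 26 := by decide +kernel
  have h26 := hc.le hq
  rcases mem_twoOptimaFacets.1 hT with hT | hT | ⟨q', hq', hT⟩
  · have := h1 T hT w hw
    omega
  · have := h2 T hT w hw
    omega
  · rcases copyTetrahedra_vertices q' hq' T hT w hw with h | h
    · omega
    · rwa [hc.eq hq hq' h]

theorem card_sigmaTwoFacets : ∀ s ∈ sigmaTwoFacets, s.card = 3 := by decide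

theorem sigmaTwo_not_subset : ∀ s ∈ sigmaTwoFacets, ∀ T ∈ twoOptimaFacets, T.card = 4 →
    ¬ s ⊆ T := by
  -- The vertices `22, …, 25` are those of `Σ₂` that no tetrahedron contains.
  have h1 : ∀ s ∈ sigmaTwoFacets, ∃ w ∈ s, 22 ≤ w ∧ w < 26 := by decide +kernel
  have h2 : ∀ T ∈ twoOptimaFacets, T.card = 4 → ∀ w ∈ T, w < 22 ∨ 26 ≤ w := by decide +kernel
  intro s hs T hT h4 hsub
  obtain ⟨w, hw, h⟩ := h1 s hs
  have := h2 T hT h4 w (hsub hw)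
  omega

/-- The twelve triangles of `Σ₂` and the nine glueing triangles form a surface-like complex without
free edges; this is the hypothesis `hedge` of `IsMorseOn.false_of_regions`. -/
theorem exists_other_triangle : ∀ s ∈ sigmaTwoFacets ++ gluingData.map gluingTriangle, ∀ v ∈ s,
    (∃ s' ∈ sigmaTwoFacets, s' ≠ s ∧ s.erase v ⊆ s') ∨
      ∃ q ∈ gluingData, gluingTriangle q ≠ s ∧ s.erase v ⊆ gluingTriangle q := by
  decide +kernel

/-- A discrete Morse function on `two_optima` has a critical face of dimension at least two. -/
theorem exists_critical_of_two_lt_card {f : twoOptima.faces → ℝ}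
    (hf : IsDiscreteMorseFunction f) : ∃ σ, IsFormanCritical f σ ∧ 2 < σ.1.card := by
  by_contra! hno
  have hnc : ∀ σ : twoOptima.faces, 2 < σ.1.card → ¬ IsFormanCritical f σ := fun σ h hc =>
    absurd (hno σ hc) (by omega)
  have hmemF : ∀ q : {q // q ∈ gluingData}, ∀ T ∈ (copyTetrahedra q.1).toFinset,
      T ∈ twoOptima.faces ∧ T.card = 4 := by
    intro q T hT
    rw [List.mem_toFinset] at hT
    have h4 := card_copyTetrahedra q.1 q.2 T hT
    exact ⟨mem_twoOptima_of_mem_facets (mem_twoOptimaFacets_of_mem_copy q.2 hT)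
      (by rw [← Finset.card_pos]; omega), h4⟩
  have hne : ∀ q ∈ gluingData, copyTetrahedra q ≠ [] := by decide +kernel
  refine hf.isMorseOn.false_of_regions (ι := {q // q ∈ gluingData})
    (R := fun q => (copyTetrahedra q.1).toFinset) (t := fun q => gluingTriangle q.1)
    (P := {s | s ∈ sigmaTwoFacets}) finite_twoOptima
    (fun τ hτ σ h hne => twoOptima_down hτ h hne) ?_ ?_ ?_ (fun q T hT => (hmemF q T hT).1)
    (fun q T hT => (hmemF q T hT).2) ?_ ?_ ?_ ⟨{1, 3, 23}, by decide⟩ ?_ ?_ ?_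
  · intro T hT h4
    refine exists_le_extendByZero_erase (σ := ⟨T, hT⟩) (hnc _ (by simp only; omega)) ?_
    rintro τ ⟨h, -⟩
    have h1 := h.2
    have h2 := card_le_four τ.2
    simp only at h1
    omega
  · intro t ht h3 hup
    refine exists_le_extendByZero_erase (σ := ⟨t, ht⟩) (hnc _ (by simp only; omega)) ?_
    rintro τ ⟨h, hle⟩
    have h1 := h.2
    simp only at h1
    have := hup τ.1 τ.2 (by omega) h.1.subset
    rw [extendByZero_of_mem f ht, extendByZero_of_mem f τ.2] at this
    exact absurd hle (not_le.2 this)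
  · intro q
    rw [List.toFinset_nonempty_iff]
    exact hne q.1 q.2
  · intro q T hT v hv hqv
    rw [List.mem_toFinset] at hT
    obtain ⟨T', hT', h⟩ := (copyTetrahedra_interior q.1 q.2 T hT v hv).resolve_left hqv
    exact ⟨T', List.mem_toFinset.2 hT', h⟩
  · intro q T hT v hv hqv T' hT' h4 hsub
    rw [List.mem_toFinset] at hT ⊢
    obtain ⟨w, hw, hc⟩ := (exists_isCopyVertex q.1 q.2 T hT v hv).resolve_left hqv
    exact mem_copy_of_isCopyVertex q.2 (mem_facets_of_card_eq_four hT' h4) (hsub hw) hc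
  · intro q q' hqq' T hT hT'
    rw [List.mem_toFinset] at hT hT'
    obtain ⟨w, hw, hc⟩ := exists_isCopyVertex_tetrahedron q.1 q.2 T hT
    rcases copyTetrahedra_vertices q'.1 q'.2 T hT' w hw with h | h
    · have := hc.le q.2
      omega
    · exact hqq' (Subtype.ext (hc.eq q.2 q'.2 h))
  · intro s hs
    have h3 := card_sigmaTwoFacets s hs
    exact ⟨mem_twoOptima_of_mem_facets (mem_twoOptimaFacets.2 (Or.inl hs))
      (by rw [← Finset.card_pos]; omega), h3⟩
  · intro s hs T hT h4
    exact sigmaTwo_not_subset s hs T (mem_facets_of_card_eq_four hT h4) h4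
  · intro e he s hs hes
    have hs' : s ∈ sigmaTwoFacets ++ gluingData.map gluingTriangle := by
      rw [List.mem_append, List.mem_map]
      rcases hs with hs | ⟨q, rfl⟩
      · exact Or.inl hs
      · exact Or.inr ⟨q.1, q.2, rfl⟩
    have h3 : ∀ s ∈ sigmaTwoFacets ++ gluingData.map gluingTriangle, s.card = 3 := by
      decide +kernel
    have hcard : (s \ e).card = 1 := by
      rw [Finset.card_sdiff_of_subset hes, h3 s hs', he]
    obtain ⟨v, hv⟩ := Finset.card_eq_one.1 hcard
    have hv' : v ∈ s ∧ v ∉ e := by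
      rw [← Finset.mem_sdiff, hv]; simp
    have hev : e = s.erase v := by
      refine Finset.eq_of_subset_of_card_le (Finset.subset_erase.2 ⟨hes, hv'.2⟩) ?_
      have := Finset.card_erase_add_one hv'.1
      have := h3 s hs'
      omega
    rw [hev]
    rcases exists_other_triangle s hs' v hv'.1 with h | ⟨q, hq, h⟩
    · exact Or.inl h
    · exact Or.inr ⟨⟨q, hq⟩, h⟩

/-- A critical vertex and a critical face of dimension at least two make two critical faces; the
number has the same parity as the three of the explicit function, so it is at least three. -/
theorem three_le_ncard_critical {f : twoOptima.faces → ℝ} (hf : IsDiscreteMorseFunction f) :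
    3 ≤ {σ | IsFormanCritical f σ}.ncard := by
  obtain ⟨g, hg, hgv⟩ := exists_discreteMorse_twoOptima_vector
  have h3 : {σ | IsFormanCritical g σ}.ncard = 3 := by
    rw [← sum_faceCountVector, hgv]
    rfl
  have hpar := hf.ncard_critical_mod_two.trans hg.ncard_critical_mod_two.symm
  rw [h3] at hpar
  obtain ⟨σ, hσ, hσ1⟩ := hf.exists_critical_vertex
  obtain ⟨τ, hτ, hτ2⟩ := exists_critical_of_two_lt_card hf
  have hne : σ ≠ τ := by
    rintro rfl
    omega
  have h2 : 2 ≤ {σ | IsFormanCritical f σ}.ncard := by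
    rw [← Set.ncard_pair hne]
    refine Set.ncard_le_ncard ?_ (Set.toFinite _)
    rintro ρ (rfl | rfl)
    · exact hσ
    · exact hτ
  rw [Nat.ModEq] at hpar
  omega

theorem mainTheorem9 :
    [1, 0, 1, 1] ∈ optimalDiscreteMorseVectors twoOptima ∧
    (∀ f : twoOptima.faces → ℤ, IsMonotoneDiscreteMorseFunction f →
      faceCountVector twoOptima (IsLevelCritical f) ≠ [1, 0, 1, 1]) ∧
    ¬ optimalDiscreteMorseVectors twoOptima ⊆ discreteMorseSpectrum twoOptima := by
  have h1 : [1, 0, 1, 1] ∈ optimalDiscreteMorseVectors twoOptima := by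
    refine ⟨exists_discreteMorse_twoOptima_vector, ?_⟩
    rintro w ⟨f, hf, rfl⟩
    rw [sum_faceCountVector]
    exact three_le_ncard_critical hf
  refine ⟨h1, fun f hf => faceCountVector_ne_of_isMonotone hf, fun hsub => ?_⟩
  obtain ⟨f, hf, hv⟩ := hsub h1
  exact faceCountVector_ne_of_isMonotone hf hv
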